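/- Let $d\ge 2$ be an integer, let $P^{anti}$ be the orthogonal projector onto the antisymmetric subspace of $\mathbb C^d\otimes\mathbb C^d$, and for real $\alpha$ let $$\rho_W=\alpha\,\frac{2P^{anti}}{d(d-1)}+(1-\alpha)\,\frac{\mathbb I_{d^2}}{d^2}$$ be the Werner state. Put $\alpha^\ast=\frac{3d-1}{d+1}(d-1)^{d-1}d^{-d}$ and suppose that $\frac1{d+1}<\alpha\le\alpha^\ast$. POVMs have finitely many outcomes. A state is entangled if it is not a finite convex combination of product states. A state $\rho$ admits a local hidden state (LHS) model for POVMs from Alice to Bob if there are a probability measure $\pi$, measurably depending quantum states $\sigma_\lambda$ of Bob, and, for every POVM $M$ of Alice, a response function (a probability distribution $p(\cdot\,|M,\lambda)$ on the outcomes, measurable in $\lambda$), with $$\mathrm{tr}_A\big[(M_a\otimes\mathbb I)\rho\big]=\int p(a|M,\lambda)\,\sigma_\lambda\,d\pi(\lambda)\qquad\text{for all } M \text{ and } a ;$$ $\pi$ and $\sigma_\lambda$ are the same for all $M$. Then Alice cannot steer Bob with POVMs. The definition from Bob to Alice is the same with the parties exchanged. Barrett's model is the following. The hidden variable is a unit vector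 $|\lambda\rangle\in\mathbb C^d$ with the uniform distribution. Write each POVM as a coarse-graining $M_a=\sum_{k:\,f(k)=a}w_kP_k$ with $w_k\ge0$ and rank-one projectors $P_k$, which is always possible; fix any such choice for every POVM. Put $q_k(\lambda)=\langle\lambda|P_k|\lambda\rangle$, and let $c_k(\lambda)=w_kq_k(\lambda)$ if $q_k(\lambda)\ge\frac1d$ and $c_k(\lambda)=0$ otherwise. The response functions of the two parties are $$p_1(a|M,\lambda)=\sum_{f(k)=a}\Big[\tfrac{\alpha}{\alpha^\ast}\Big(c_k(\lambda)+\tfrac{w_k}{d}\big(1-\textstyle\sum_{k'}c_{k'}(\lambda)\big)\Big)+\big(1-\tfrac{\alpha}{\alpha^\ast}\big)\tfrac{w_k}{d}\Big],$$ $$p_2(a|M,\lambda)=\sum_{f(k)=a}\frac{w_k}{d-1}\big(1-\mathrm{tr}[|\lambda\rangle\langle\lambda|P_k]\big).$$ Then: 1. $\rho_W$ is an entangled state. 2. Barrett's model is a local hidden variable model for all POVMs on $\rho_W$: $p_1$ and $p_2$ are response functions and $\mathrm{tr}[(M_a\otimes N_b)\rho_W]=\int p_1(a|M,\lambda)\,p_2(b|N,\lambda)\,d\lambda$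 for all POVMs $M,N$ and outcomes $a,b$; the same holds with the roles of the two parties exchanged. 3. It is an LHS model with hidden states $\sigma_\lambda=\frac{\mathbb I_d-|\lambda\rangle\langle\lambda|}{d-1}$: one has $p_2(a|M,\lambda)=\mathrm{tr}(\sigma_\lambda M_a)$ for all $M$, $a$, $\lambda$, and $p_1$ with the hidden states $\sigma_\lambda$ is an LHS model for POVMs of $\rho_W$, both from Alice to Bob and from Bob to Alice. 4. Hence $\rho_W$ cannot be steered with POVMs from Alice to Bob, nor from Bob to Alice. -/

import Mathlib

open MeasureTheory
open scoped Kronecker ComplexOrder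

noncomputable section

namespace Steering

variable {ι κ : Type} [Fintype ι] [DecidableEq ι] [Fintype κ] [DecidableEq κ]

/-- A quantum state (density matrix): positive semidefinite with unit trace. -/
structure IsState (ρ : Matrix ι ι ℂ) : Prop where
  posSemidef : ρ.PosSemidef
  trace_eq_one : ρ.trace = 1

/-- A bipartite matrix is separable if it is a finite convex combination of products of states. -/
def IsSeparable (ρ : Matrix (ι × κ) (ι × κ) ℂ) : Prop :=
  ∃ (k : ℕ) (p : Fin k → ℝ) (σ : Fin k → Matrix ι ι ℂ) (τ : Fin k → Matrix κ κ ℂ),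
    (∀ i, 0 ≤ p i) ∧ ∑ i, p i = 1 ∧ (∀ i, IsState (σ i)) ∧ (∀ i, IsState (τ i)) ∧
      ρ = ∑ i, (p i : ℂ) • (σ i ⊗ₖ τ i)

/-- An entangled state is a state that is not separable. -/
def IsEntangled (ρ : Matrix (ι × κ) (ι × κ) ℂ) : Prop :=
  IsState ρ ∧ ¬ IsSeparable ρ

/-- A POVM with `n` outcomes on the Hilbert space with orthonormal basis indexed by `ι`. -/
structure POVM (ι : Type) [Fintype ι] [DecidableEq ι] (n : ℕ) where
  elem : Fin n → Matrix ι ι ℂ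
  posSemidef : ∀ a, (elem a).PosSemidef
  sum_eq_one : ∑ a, elem a = 1

/-- Partial trace over the first (Alice's) factor. -/
def traceA (X : Matrix (ι × κ) (ι × κ) ℂ) : Matrix κ κ ℂ :=
  Matrix.of fun i j => ∑ k, X (k, i) (k, j)

/-- Partial trace over the second (Bob's) factor. -/
def traceB (X : Matrix (ι × κ) (ι × κ) ℂ) : Matrix ι ι ℂ :=
  Matrix.of fun i j => ∑ k, X (i, k) (j, k)

/-- The full assemblage of subnormalised states of Bob: for each POVM `M` of Alice and each
outcome `a`, the matrix `tr_A ((M_a ⊗ 1) ρ)`. -/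
def assemblageAtoB (ρ : Matrix (ι × κ) (ι × κ) ℂ) (n : ℕ) (M : POVM ι n) (a : Fin n) :
    Matrix κ κ ℂ :=
  traceA ((M.elem a ⊗ₖ (1 : Matrix κ κ ℂ)) * ρ)

/-- The full assemblage of subnormalised states of Alice: for each POVM `M` of Bob and each
outcome `b`, the matrix `tr_B ((1 ⊗ M_b) ρ)`. -/
def assemblageBtoA (ρ : Matrix (ι × κ) (ι × κ) ℂ) (n : ℕ) (M : POVM κ n) (b : Fin n) :
    Matrix ι ι ℂ :=
  traceB (((1 : Matrix ι ι ℂ) ⊗ₖ M.elem b) * ρ)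

/-- A family of local response functions `p n M a l = p(a | M, l)`: for every POVM `M` and every
value `l` of the hidden variable, a probability distribution on the outcomes, depending
measurably on `l`. -/
structure IsResponse {Λ : Type} [MeasurableSpace Λ]
    (p : (n : ℕ) → POVM ι n → Fin n → Λ → ℝ) : Prop where
  measurable : ∀ n M a, Measurable (p n M a)
  nonneg : ∀ n M a l, 0 ≤ p n M a l
  sum_eq_one : ∀ n M l, ∑ a, p n M a l = 1

/-- The hidden variable `l` with law `μ`, the hidden states `σ l` and the response functions `p`
form a local hidden state model for the assemblage `S` indexed by all POVMs:
`S_{a|M} = ∫ p(a | M, l) σ_l dμ(l)`, the integral being taken entrywise. -/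
structure IsLHSModel (S : (n : ℕ) → POVM ι n → Fin n → Matrix κ κ ℂ)
    {Λ : Type} [MeasurableSpace Λ] (μ : Measure Λ) (σ : Λ → Matrix κ κ ℂ)
    (p : (n : ℕ) → POVM ι n → Fin n → Λ → ℝ) : Prop where
  isProbabilityMeasure : IsProbabilityMeasure μ
  measurable_state : ∀ i j, Measurable fun l => σ l i j
  isState : ∀ l, IsState (σ l)
  isResponse : IsResponse p
  reproduces : ∀ n M a i j, S n M a i j = ∫ l, (p n M a l : ℂ) * σ l i j ∂μ

/-- Existence of a local hidden state model, valid for all POVMs simultaneously. -/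
def HasLHSModel (S : (n : ℕ) → POVM ι n → Fin n → Matrix κ κ ℂ) : Prop :=
  ∃ (Λ : Type) (_ : MeasurableSpace Λ) (μ : Measure Λ) (σ : Λ → Matrix κ κ ℂ)
    (p : (n : ℕ) → POVM ι n → Fin n → Λ → ℝ), IsLHSModel S μ σ p

/-- Alice cannot steer Bob with POVMs. -/
def UnsteerableAtoB (ρ : Matrix (ι × κ) (ι × κ) ℂ) : Prop :=
  HasLHSModel (assemblageAtoB ρ)

/-- Bob cannot steer Alice with POVMs. -/
def UnsteerableBtoA (ρ : Matrix (ι × κ) (ι × κ) ℂ) : Prop :=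
  HasLHSModel (assemblageBtoA ρ)

/-- A local hidden variable model for all pairs of POVMs performed on `ρ`. -/
structure IsLHVModel (ρ : Matrix (ι × κ) (ι × κ) ℂ)
    {Λ : Type} [MeasurableSpace Λ] (μ : Measure Λ)
    (pA : (n : ℕ) → POVM ι n → Fin n → Λ → ℝ)
    (pB : (n : ℕ) → POVM κ n → Fin n → Λ → ℝ) : Prop where
  isProbabilityMeasure : IsProbabilityMeasure μ
  isResponseA : IsResponse pA
  isResponseB : IsResponse pB
  reproduces : ∀ (m n : ℕ) (M : POVM ι m) (N : POVM κ n) (a : Fin m) (b : Fin n),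
    ((M.elem a ⊗ₖ N.elem b) * ρ).trace = ((∫ l, pA m M a l * pB n N b l ∂μ : ℝ) : ℂ)

/-! ### Werner states -/

/-- The swap operator on `ℂ^d ⊗ ℂ^d`. -/
def swapMatrix (d : ℕ) : Matrix (Fin d × Fin d) (Fin d × Fin d) ℂ :=
  Matrix.of fun i j => if i = j.swap then 1 else 0

/-- The projector on the antisymmetric subspace of `ℂ^d ⊗ ℂ^d`; it is shown
below to be Hermitian and idempotent, with the antisymmetric vectors as its fixed points. -/
def antisymProj (d : ℕ) : Matrix (Fin d × Fin d) (Fin d × Fin d) ℂ :=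
  (1 / 2 : ℂ) • (1 - swapMatrix d)

theorem swapMatrix_mulVec (d : ℕ) (v : Fin d × Fin d → ℂ) (i : Fin d × Fin d) :
    (swapMatrix d).mulVec v i = v i.swap := by
  have h : ∀ x : Fin d × Fin d, (i = x.swap) ↔ (i.swap = x) := fun x =>
    ⟨fun h => by rw [h, Prod.swap_swap], fun h => by rw [← h, Prod.swap_swap]⟩
  simp [swapMatrix, Matrix.mulVec, dotProduct, h]

theorem antisymProj_mulVec (d : ℕ) (v : Fin d × Fin d → ℂ) (i : Fin d × Fin d) :
    (antisymProj d).mulVec v i = (v i - v i.swap) / 2 := by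
  rw [antisymProj, Matrix.smul_mulVec, Matrix.sub_mulVec, Matrix.one_mulVec]
  simp only [Pi.smul_apply, Pi.sub_apply, swapMatrix_mulVec, smul_eq_mul]
  ring

theorem antisymProj_isHermitian (d : ℕ) : (antisymProj d).IsHermitian := by
  have h1 : (swapMatrix d).IsHermitian := by
    ext ⟨i, i'⟩ ⟨j, j'⟩
    have h : (j = i' ∧ j' = i) ↔ (i = j' ∧ i' = j) :=
      ⟨fun h => ⟨h.2.symm, h.1.symm⟩, fun h => ⟨h.2.symm, h.1.symm⟩⟩
    simp [swapMatrix, h, apply_ite]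
  have h2 : star (1 / 2 : ℂ) = 1 / 2 := by simp
  rw [Matrix.IsHermitian, antisymProj, Matrix.conjTranspose_smul, Matrix.conjTranspose_sub,
    Matrix.conjTranspose_one, h1.eq, h2]

theorem antisymProj_mul_self (d : ℕ) : antisymProj d * antisymProj d = antisymProj d := by
  refine Matrix.ext_of_mulVec_single fun k => ?_
  rw [← Matrix.mulVec_mulVec]
  ext i
  rw [antisymProj_mulVec, antisymProj_mulVec, antisymProj_mulVec, Prod.swap_swap]
  ring

theorem antisymProj_mulVec_eq_self_iff (d : ℕ) (v : Fin d × Fin d → ℂ) :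
    (antisymProj d).mulVec v = v ↔ ∀ i j, v (j, i) = -v (i, j) := by
  constructor
  · intro h i j
    have := congrFun h (i, j)
    rw [antisymProj_mulVec, Prod.swap_prod_mk] at this
    linear_combination (-2 : ℂ) * this
  · intro h
    ext ⟨i, j⟩
    rw [antisymProj_mulVec, Prod.swap_prod_mk, h i j]
    ring

/-- The Werner state `α · 2 P^anti / (d (d-1)) + (1 - α) · 1 / d²`. -/
def wernerState (d : ℕ) (α : ℝ) : Matrix (Fin d × Fin d) (Fin d × Fin d) ℂ :=
  ((α * (2 / ((d : ℝ) * ((d : ℝ) - 1))) : ℝ) : ℂ) • antisymProj d +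
    (((1 - α) / (d : ℝ) ^ 2 : ℝ) : ℂ) • (1 : Matrix (Fin d × Fin d) (Fin d × Fin d) ℂ)

/-- The threshold `(3d-1)/(d+1) · (d-1)^(d-1) · d^(-d)`. -/
def barrettBound (d : ℕ) : ℝ :=
  (3 * (d : ℝ) - 1) / ((d : ℝ) + 1) * ((d : ℝ) - 1) ^ (d - 1) * ((d : ℝ) ^ d)⁻¹

/-! ### Barrett's model -/

/-- Unit vectors of `ℂ^d`. -/
abbrev UnitVec (d : ℕ) : Type := Metric.sphere (0 : EuclideanSpace ℂ (Fin d)) 1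

/-- The uniform (unitarily invariant) probability measure on unit vectors: normalised surface
measure. -/
def uniformUnitVec (d : ℕ) : Measure (UnitVec d) :=
  ((volume : Measure (EuclideanSpace ℂ (Fin d))).toSphere Set.univ)⁻¹ •
    (volume : Measure (EuclideanSpace ℂ (Fin d))).toSphere

/-- The projector `|v⟩⟨v|`. -/
def ketbra {d : ℕ} (v : UnitVec d) : Matrix (Fin d) (Fin d) ℂ :=
  Matrix.of fun i j => v.1 i * star (v.1 j)

/-- The overlap `tr (|v⟩⟨v| |w⟩⟨w|) = |⟨v, w⟩|²`. -/
def overlap {d : ℕ} (v w : UnitVec d) : ℝ := ‖inner ℂ v.1 w.1‖ ^ 2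

/-- The hidden state `(1 - |l⟩⟨l|) / (d - 1)`. -/
def hiddenState (d : ℕ) (l : UnitVec d) : Matrix (Fin d) (Fin d) ℂ :=
  (((d : ℝ) - 1 : ℝ) : ℂ)⁻¹ • (1 - ketbra l)

/-- A fine-graining of the POVM `M` into rank-one elements `weight k • |vec k⟩⟨vec k|`, the
outcome `k` of which is relabelled `label k`. -/
structure RankOneRefinement {d n : ℕ} (M : POVM (Fin d) n) where
  size : ℕ
  weight : Fin size → ℝ
  weight_nonneg : ∀ k, 0 ≤ weight k
  vec : Fin size → UnitVec d
  label : Fin size → Fin n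
  elem_eq : ∀ a, M.elem a = ∑ k with label k = a, (weight k : ℂ) • ketbra (vec k)

namespace RankOneRefinement

variable {d n : ℕ} {M : POVM (Fin d) n}

/-- `⟨l| M_k |l⟩ Θ(⟨l| P_k |l⟩ - 1/d)` for the rank-one element `M_k = w_k P_k`. -/
def clipped (R : RankOneRefinement M) (k : Fin R.size) (l : UnitVec d) : ℝ :=
  if 1 / (d : ℝ) ≤ overlap (R.vec k) l then R.weight k * overlap (R.vec k) l else 0

/-- The response of the untrusted party at the threshold visibility. -/
def response (R : RankOneRefinement M) (a : Fin n) (l : UnitVec d) : ℝ :=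
  ∑ k with R.label k = a,
    (R.clipped k l + R.weight k / (d : ℝ) * (1 - ∑ k', R.clipped k' l))

/-- White noise: the outcome `k` is drawn with probability `w_k / d`. -/
def noise (R : RankOneRefinement M) (a : Fin n) : ℝ :=
  ∑ k with R.label k = a, R.weight k / (d : ℝ)

/-- The response of the other party, `w_k / (d-1) · (1 - tr (|l⟩⟨l| P_k))`. -/
def quantumResponse (R : RankOneRefinement M) (a : Fin n) (l : UnitVec d) : ℝ :=
  ∑ k with R.label k = a, R.weight k / ((d : ℝ) - 1) * (1 - overlap (R.vec k) l)

end RankOneRefinement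

/-- First response function of Barrett's model at visibility `α`: the response at the threshold
visibility, mixed with white noise in proportion `1 - α / barrettBound d`. -/
def barrettResponse {d : ℕ} (α : ℝ)
    (R : (n : ℕ) → (M : POVM (Fin d) n) → RankOneRefinement M)
    (n : ℕ) (M : POVM (Fin d) n) (a : Fin n) (l : UnitVec d) : ℝ :=
  α / barrettBound d * (R n M).response a l + (1 - α / barrettBound d) * (R n M).noise a

/-- Second response function of Barrett's model. -/
def barrettQuantumResponse {d : ℕ}
    (R : (n : ℕ) → (M : POVM (Fin d) n) → RankOneRefinement M)
    (n : ℕ) (M : POVM (Fin d) n) (a : Fin n) (l : UnitVec d) : ℝ :=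
  (R n M).quantumResponse a l

end Steering

end

/-! The swap operator $F$ witnesses entanglement:
$\mathrm{tr}[F(\sigma\otimes\tau)]=\mathrm{tr}(\sigma\tau)\ge0$ on product states, whereas
$\mathrm{tr}(F\rho_W)=(1-\alpha(d+1))/d<0$ for $\alpha>1/(d+1)$.

For the models, symmetry does most of the work. The average of $|\lambda\rangle\langle\lambda|$
weighted by a function of $|\langle v|\lambda\rangle|^2$ commutes with the symmetries fixing $v$, so
it is $A\,|v\rangle\langle v|+\beta\,\mathbb I$ (`integral_comp_overlap_mul_ketbra`). Two scalar
moments fix $A$ and $\beta$; they are one-dimensional integrals because $|\lambda_0|^2$ has density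
$(d-1)(1-q)^{d-2}$ on $[0,1]$, a law read off from Gaussian integrals over cones
(`gaussian_cone_pi`). For the clipped overlap, $A=\alpha^\ast/d$
(`exists_integral_clip_mul_ketbra`), which is where the threshold comes from.

In the average of the threshold response against $\sigma_\lambda$ the normalising term cancels
$\beta$, and what remains is the assemblage of $\rho_W$ at $\alpha=\alpha^\ast$
(`integral_response_mul_hiddenState`). That assemblage is affine in $\alpha$, and at $\alpha=0$
white noise produces it, so mixing with noise reaches every $\alpha\in[0,\alpha^\ast]$. By the swap
symmetry of $\rho_W$ the same formula serves both steering directions.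

Since $p_2(b|N,\lambda)=\mathrm{tr}(\sigma_\lambda N_b)$, pairing the LHS identity with $N_b$ gives
the LHV identity (`IsLHSModel.trace_mul`). -/

noncomputable section

namespace Steering

/-! ### Gaussian integrals over cones -/

section Gaussian

theorem integral_exp_neg_mul_norm_sq_complex {b : ℝ} (hb : 0 < b) :
    ∫ z : ℂ, Real.exp (-b * ‖z‖ ^ 2) = Real.pi / b := by
  rw [GaussianFourier.integral_rexp_neg_mul_sq_norm hb, Complex.finrank_real_complex]
  simp

theorem integrable_exp_neg_mul_norm_sq_complex {b : ℝ} (hb : 0 < b) :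
    Integrable fun z : ℂ => Real.exp (-b * ‖z‖ ^ 2) := by
  by_contra h
  have h1 := integral_exp_neg_mul_norm_sq_complex hb
  -- A non-integrable function has integral 0 by convention, but this integral is positive.
  rw [integral_undef h] at h1
  exact (div_pos Real.pi_pos hb).ne h1

/-- The radial tail of the standard Gaussian on `ℂ`. -/
theorem integral_exp_neg_norm_sq_tail {a : ℝ} (ha : 0 ≤ a) :
    ∫ z : ℂ, (if a ≤ ‖z‖ ^ 2 then Real.exp (-‖z‖ ^ 2) else 0) = Real.pi * Real.exp (-a) := by
  rw [integral_fun_norm_addHaar volume fun y : ℝ => if a ≤ y ^ 2 then Real.exp (-y ^ 2) else 0,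
    Complex.finrank_real_complex]
  have hball : volume.real (Metric.ball (0 : ℂ) 1) = Real.pi := by
    simp [Measure.real, Complex.volume_ball]
  have hind : ∫ y in Set.Ioi (0 : ℝ), y ^ (2 - 1) • (if a ≤ y ^ 2 then Real.exp (-y ^ 2) else 0) =
      ∫ y in Set.Ioi (√a), y * Real.exp (-y ^ 2) := by
    -- The right-hand range is closed at `√a`, so that the indicators agree at every point: the
    -- condition `a ≤ y ^ 2` includes the endpoint, and for `a = 0` the factor `y` vanishes there.
    rw [← integral_indicator measurableSet_Ioi, ← integral_Ici_eq_integral_Ioi,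
      ← integral_indicator measurableSet_Ici]
    congr 1
    ext y
    by_cases hy : √a ≤ y
    · have hy0 : 0 ≤ y := (Real.sqrt_nonneg a).trans hy
      have hay : a ≤ y ^ 2 := (Real.sqrt_le_left hy0).1 hy
      rcases hy0.eq_or_lt with rfl | h
      · simp [Set.indicator]
      · simp [Set.indicator, hy, h, hay]
    · rcases le_or_gt y 0 with h | h
      · simp [Set.indicator, hy, h]
      · have : ¬ a ≤ y ^ 2 := fun h' => hy ((Real.sqrt_le_left h.le).2 h')
        simp [Set.indicator, hy, this]
  have hderiv : ∀ x ∈ Set.Ioi (√a),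
      HasDerivAt (fun y : ℝ => -(1 / 2) * Real.exp (-y ^ 2)) (x * Real.exp (-x ^ 2)) x := by
    intro x _
    have := (((hasDerivAt_pow 2 x).neg).exp).const_mul (-(1 / 2) : ℝ)
    refine HasDerivAt.congr_deriv this ?_
    simp only [Pi.neg_apply]
    push_cast
    ring
  have htend : Filter.Tendsto (fun y : ℝ => -(1 / 2) * Real.exp (-y ^ 2)) Filter.atTop
      (nhds (-(1 / 2) * 0)) := by
    refine Filter.Tendsto.const_mul _ (Real.tendsto_exp_neg_atTop_nhds_zero.comp ?_)
    exact Filter.tendsto_pow_atTop two_ne_zero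
  have hint : ∫ y in Set.Ioi (√a), y * Real.exp (-y ^ 2) = Real.exp (-a) / 2 := by
    rw [integral_Ioi_of_hasDerivAt_of_nonneg (by fun_prop) hderiv ?_ htend, Real.sq_sqrt ha]
    · ring
    · intro x hx
      exact mul_nonneg ((Real.sqrt_nonneg a).trans (le_of_lt hx)) (Real.exp_pos _).le
  rw [hball, hind, hint]
  simp
  ring

/-- With $R$ the sum of the other squared moduli, integrating out $x_0$ over the tail gives $\pi
e^{-sR}$. The remaining integrand is a product Gaussian $e^{-R/(1-t)}$ in $m$ variables, each
contributing $\pi(1-t)$. -/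
theorem gaussian_cone_pi (m : ℕ) {t : ℝ} (ht0 : 0 ≤ t) (ht1 : t < 1) :
    ∫ x : Fin (m + 1) → ℂ, (if t * ∑ i, ‖x i‖ ^ 2 ≤ ‖x 0‖ ^ 2 then
      Real.exp (-∑ i, ‖x i‖ ^ 2) else 0) = Real.pi ^ (m + 1) * (1 - t) ^ m := by
  have h1t : 0 < 1 - t := by linarith
  -- The cone $t(u+R)\le u$ is the half-line $u\ge sR$ in the variable $u=|x_0|^2$.
  set s : ℝ := t / (1 - t) with hs
  have hs0 : 0 ≤ s := div_nonneg ht0 h1t.le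
  let G : ℂ × (Fin m → ℂ) → ℝ := fun p => Real.exp (-∑ i, ‖p.2 i‖ ^ 2) *
    (if s * ∑ i, ‖p.2 i‖ ^ 2 ≤ ‖p.1‖ ^ 2 then Real.exp (-‖p.1‖ ^ 2) else 0)
  have hG : ∀ x : Fin (m + 1) → ℂ, (if t * ∑ i, ‖x i‖ ^ 2 ≤ ‖x 0‖ ^ 2 then
      Real.exp (-∑ i, ‖x i‖ ^ 2) else 0) =
        G (MeasurableEquiv.piFinSuccAbove (fun _ => ℂ) 0 x) := by
    intro x
    have hx : ∀ i, (MeasurableEquiv.piFinSuccAbove (fun _ => ℂ) 0 x).2 i = x i.succ := fun _ => rfl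
    have hx0 : (MeasurableEquiv.piFinSuccAbove (fun _ => ℂ) 0 x).1 = x 0 := rfl
    simp only [G, hx, hx0, Fin.sum_univ_succ]
    have hiff : t * (‖x 0‖ ^ 2 + ∑ i : Fin m, ‖x i.succ‖ ^ 2) ≤ ‖x 0‖ ^ 2 ↔
        s * ∑ i : Fin m, ‖x i.succ‖ ^ 2 ≤ ‖x 0‖ ^ 2 := by
      rw [hs, div_mul_eq_mul_div, div_le_iff₀ h1t]
      constructor <;> intro h <;> linarith
    simp only [hiff]
    split_ifs
    · rw [← Real.exp_add]
      congr 1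
      ring
    · simp
  have hint : Integrable G (volume.prod volume) := by
    have hI : Integrable (fun p : ℂ × (Fin m → ℂ) =>
        Real.exp (-1 * ‖p.1‖ ^ 2) * ∏ i, Real.exp (-1 * ‖p.2 i‖ ^ 2)) (volume.prod volume) :=
      (integrable_exp_neg_mul_norm_sq_complex one_pos).mul_prod
        (Integrable.fintype_prod fun _ => integrable_exp_neg_mul_norm_sq_complex one_pos)
    refine (hI.indicator (s := {p | s * ∑ i, ‖p.2 i‖ ^ 2 ≤ ‖p.1‖ ^ 2})
      (measurableSet_le (by fun_prop) (by fun_prop))).congr (Filter.Eventually.of_forall ?_)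
    intro p
    simp only [G, Set.indicator, Set.mem_ofPred_eq]
    split_ifs
    · rw [← Real.exp_sum, mul_comm]
      simp
    · simp
  have hmp := volume_preserving_piFinSuccAbove (fun _ : Fin (m + 1) => ℂ) 0
  simp_rw [hG]
  rw [hmp.integral_comp' G, Measure.volume_eq_prod, integral_prod_symm G hint]
  have hinner : ∀ y : Fin m → ℂ, ∫ z : ℂ, G (z, y) =
      Real.pi * ∏ i, Real.exp (-(1 - t)⁻¹ * ‖y i‖ ^ 2) := by
    intro y
    have hR : 0 ≤ ∑ i, ‖y i‖ ^ 2 := Finset.sum_nonneg fun _ _ => by positivity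
    simp only [G]
    rw [integral_const_mul, integral_exp_neg_norm_sq_tail (mul_nonneg hs0 hR), ← Real.exp_sum,
      mul_left_comm, ← Real.exp_add, ← Finset.mul_sum]
    congr 2
    rw [hs]
    field_simp
    ring
  simp_rw [hinner]
  rw [integral_const_mul, volume_pi, integral_fintype_prod_eq_prod
    (fun _ : Fin m => fun z : ℂ => Real.exp (-(1 - t)⁻¹ * ‖z‖ ^ 2))]
  simp only [integral_exp_neg_mul_norm_sq_complex (inv_pos.2 h1t), Finset.prod_const,
    Finset.card_univ, Fintype.card_fin, div_inv_eq_mul,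
    mul_pow]
  ring

/-- Haar measures on the product and on the Euclidean space differ by a positive factor. Its value
is irrelevant, since only ratios of cone integrals are used later. -/
theorem gaussian_cone_euclidean (m : ℕ) :
    ∃ c : ℝ, 0 < c ∧ ∀ t : ℝ, 0 ≤ t → t < 1 →
      ∫ x : EuclideanSpace ℂ (Fin (m + 1)), (if t * ‖x‖ ^ 2 ≤ ‖x 0‖ ^ 2 then
        Real.exp (-‖x‖ ^ 2) else 0) = c * (1 - t) ^ m := by
  let L : (Fin (m + 1) → ℂ) ≃L[ℝ] EuclideanSpace ℂ (Fin (m + 1)) :=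
    (PiLp.continuousLinearEquiv 2 ℝ fun _ : Fin (m + 1) => ℂ).symm
  let ν : Measure (EuclideanSpace ℂ (Fin (m + 1))) := Measure.map L volume
  have : ν.IsAddHaarMeasure := L.isAddHaarMeasure_map volume
  have hν : volume = Measure.addHaarScalarFactor volume ν • ν :=
    Measure.isAddLeftInvariant_eq_smul volume ν
  have hc : 0 < (Measure.addHaarScalarFactor (volume : Measure (EuclideanSpace ℂ (Fin (m + 1)))) ν) :=
    Measure.addHaarScalarFactor_pos_of_isAddHaarMeasure _ _
  refine ⟨Measure.addHaarScalarFactor volume ν * Real.pi ^ (m + 1),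
    mul_pos (by exact_mod_cast hc) (by positivity), fun t ht0 ht1 => ?_⟩
  conv_lhs => rw [hν]
  rw [integral_smul_nnreal_measure]
  have hemb : MeasurableEmbedding L := L.toHomeomorph.measurableEmbedding
  rw [hemb.integral_map, mul_assoc, ← gaussian_cone_pi m ht0 ht1, NNReal.smul_def, smul_eq_mul]
  congr 2
  ext x
  rw [EuclideanSpace.norm_sq_eq]
  rfl

end Gaussian

/-! ### Polar coordinates and isometries of the unit sphere -/

section Sphere

open scoped Pointwise

variable {E : Type*} [NormedAddCommGroup E] [NormedSpace ℝ E]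

/-- Integration in polar coordinates of a product of a spherical and a radial function. -/
theorem integral_polar [MeasurableSpace E] [BorelSpace E]
    [FiniteDimensional ℝ E] [Nontrivial E] (μ : Measure E) [μ.IsAddHaarMeasure]
    (F : E → ℝ) (f : Metric.sphere (0 : E) 1 → ℝ) (g : ℝ → ℝ)
    (h : ∀ (s : Metric.sphere (0 : E) 1) (r : ℝ), 0 < r → F (r • s.1) = f s * g r) :
    ∫ x, F x ∂μ = (∫ s, f s ∂μ.toSphere) *
      ∫ r : Set.Ioi (0 : ℝ), g r ∂Measure.volumeIoiPow (Module.finrank ℝ E - 1) := by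
  have hF : ∫ x, F x ∂μ = ∫ x : ({0}ᶜ : Set E), F x ∂(μ.comap (↑)) := by
    rw [integral_subtype_comap (measurableSet_singleton _).compl, restrict_compl_singleton]
  rw [hF, ← integral_prod_mul f fun r : Set.Ioi (0 : ℝ) => g r,
    ← μ.measurePreserving_homeomorphUnitSphereProd.integral_comp
      (Homeomorph.measurableEmbedding _)]
  refine integral_congr_ae (Filter.Eventually.of_forall fun x => ?_)
  refine Eq.trans ?_ (h _ _ (homeomorphUnitSphereProd E x).2.2)
  refine congrArg F ?_
  exact congrArg Subtype.val ((homeomorphUnitSphereProd E).symm_apply_apply x).symm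

/-- The action of a linear isometry on the unit sphere. -/
def sphereMap (U : E ≃ₗᵢ[ℝ] E) (l : Metric.sphere (0 : E) 1) : Metric.sphere (0 : E) 1 :=
  ⟨U l.1, by simp⟩

theorem continuous_sphereMap (U : E ≃ₗᵢ[ℝ] E) : Continuous (sphereMap U) :=
  (U.continuous.comp continuous_subtype_val).subtype_mk _

theorem measurePreserving_sphereMap [MeasurableSpace E] [BorelSpace E]
    (μ : Measure E) (U : E ≃ₗᵢ[ℝ] E)
    (hU : MeasurePreserving U μ μ) :
    MeasurePreserving (sphereMap U) μ.toSphere μ.toSphere := by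
  refine ⟨(continuous_sphereMap U).measurable, Measure.ext fun s hs => ?_⟩
  have hm := (continuous_sphereMap U).measurable hs
  rw [Measure.map_apply (continuous_sphereMap U).measurable hs, μ.toSphere_apply' hs,
    -- The sphere measure of a set is a multiple of the volume of the cone over it, and a linear
    -- isometry carries cones to cones.
    μ.toSphere_apply' hm, ← hU.measure_preimage_emb U.toHomeomorph.measurableEmbedding
      (Set.Ioo (0 : ℝ) 1 • (Subtype.val '' s))]
  congr 2
  ext x
  simp only [Set.mem_smul, Set.mem_preimage, Set.mem_image]
  constructor
  · rintro ⟨r, hr, _, ⟨l, hl, rfl⟩, rfl⟩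
    exact ⟨r, hr, _, ⟨_, hl, rfl⟩, by simp [sphereMap]⟩
  · rintro ⟨r, hr, _, ⟨l, hl, rfl⟩, hx⟩
    refine ⟨r, hr, _, ⟨sphereMap U.symm l, ?_, rfl⟩, ?_⟩
    · convert hl
      ext
      simp [sphereMap]
    · apply U.injective
      simpa [sphereMap] using hx

end Sphere

/-! ### The uniform measure on unit vectors and the law of one coordinate -/

theorem isProbabilityMeasure_uniformUnitVec {d : ℕ} (hd : 0 < d) :
    IsProbabilityMeasure (uniformUnitVec d) := by
  have : Nonempty (Fin d) := ⟨⟨0, hd⟩⟩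
  refine ⟨?_⟩
  rw [uniformUnitVec, Measure.smul_apply, smul_eq_mul]
  refine ENNReal.inv_mul_cancel ?_ (measure_ne_top _ _)
  rw [Measure.measure_univ_ne_zero]
  exact Measure.toSphere_ne_zero _

instance instIsFiniteMeasureUniformUnitVec (d : ℕ) : IsFiniteMeasure (uniformUnitVec d) := by
  -- For `d = 0` the sphere is empty: the normalising factor is infinite, but it multiplies the zero
  -- measure.
  rcases Nat.eq_zero_or_pos d with rfl | h
  · have : Subsingleton (EuclideanSpace ℂ (Fin 0)) := inferInstance
    have h0 : (volume : Measure (EuclideanSpace ℂ (Fin 0))).toSphere = 0 :=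
      (Measure.toSphere_eq_zero_iff _).2 this
    refine ⟨?_⟩
    simp [uniformUnitVec, h0]
  · have := isProbabilityMeasure_uniformUnitVec h
    infer_instance

/-- The uniform measure on unit vectors is unitarily invariant. -/
theorem measurePreserving_sphereMap_uniformUnitVec {d : ℕ}
    (U : EuclideanSpace ℂ (Fin d) ≃ₗᵢ[ℝ] EuclideanSpace ℂ (Fin d)) :
    MeasurePreserving (sphereMap U) (uniformUnitVec d) (uniformUnitVec d) :=
  (measurePreserving_sphereMap volume U U.measurePreserving).smul_measure _

theorem integral_comp_sphereMap {d : ℕ} {F : Type*} [NormedAddCommGroup F] [NormedSpace ℝ F]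
    (U : EuclideanSpace ℂ (Fin d) ≃ₗᵢ[ℝ] EuclideanSpace ℂ (Fin d)) (f : UnitVec d → F) :
    ∫ l, f (sphereMap U l) ∂uniformUnitVec d = ∫ l, f l ∂uniformUnitVec d := by
  have hinv : Function.LeftInverse (sphereMap U.symm) (sphereMap U) := fun l =>
    Subtype.ext (U.symm_apply_apply l.1)
  have hinv' : Function.RightInverse (sphereMap U.symm) (sphereMap U) := fun l =>
    Subtype.ext (U.apply_symm_apply l.1)
  let e : UnitVec d ≃ₜ UnitVec d :=
    ⟨⟨sphereMap U, sphereMap U.symm, hinv, hinv'⟩, continuous_sphereMap U,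
      continuous_sphereMap U.symm⟩
  exact (measurePreserving_sphereMap_uniformUnitVec U).integral_comp e.measurableEmbedding f

theorem norm_unitVec {d : ℕ} (l : UnitVec d) : ‖l.1‖ = 1 := by simp

theorem sum_norm_sq_unitVec {d : ℕ} (l : UnitVec d) : ∑ i, ‖l.1 i‖ ^ 2 = 1 := by
  rw [← EuclideanSpace.norm_sq_eq, norm_unitVec, one_pow]

theorem continuous_unitVec_apply {d : ℕ} (i : Fin d) : Continuous fun l : UnitVec d => l.1 i := by
  fun_prop

/-- The tail of the squared modulus of a coordinate of a uniform unit vector. -/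
theorem uniformUnitVec_real_tail {m : ℕ} {t : ℝ} (ht0 : 0 ≤ t) (ht1 : t < 1) :
    (uniformUnitVec (m + 1)).real {l | t ≤ ‖l.1 0‖ ^ 2} = (1 - t) ^ m := by
  obtain ⟨c, hc, hcone⟩ := gaussian_cone_euclidean m
  -- The cone condition depends on the direction only and the Gaussian on the radius only, so the
  -- integral factors with a radial constant independent of $t$. The case $t=0$, where the cone is
  -- the whole space, then normalises the tail.
  have hpolar : ∀ t : ℝ, ∫ x : EuclideanSpace ℂ (Fin (m + 1)),
      (if t * ‖x‖ ^ 2 ≤ ‖x 0‖ ^ 2 then Real.exp (-‖x‖ ^ 2) else 0) =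
      (volume : Measure (EuclideanSpace ℂ (Fin (m + 1)))).toSphere.real
        {l | t ≤ ‖l.1 0‖ ^ 2} *
      ∫ r : Set.Ioi (0 : ℝ), Real.exp (-(r : ℝ) ^ 2) ∂Measure.volumeIoiPow
        (Module.finrank ℝ (EuclideanSpace ℂ (Fin (m + 1))) - 1) := by
    intro t
    have hmeas : MeasurableSet {l : UnitVec (m + 1) | t ≤ ‖l.1 0‖ ^ 2} :=
      measurableSet_le measurable_const ((continuous_unitVec_apply 0).norm.pow 2).measurable
    rw [integral_polar volume _ (Set.indicator {l : UnitVec (m + 1) | t ≤ ‖l.1 0‖ ^ 2} 1)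
      (fun r => Real.exp (-r ^ 2)), integral_indicator_one hmeas]
    intro s r hr
    have hs : ‖s.1‖ = 1 := by simp
    have h1 : t * r ^ 2 ≤ (r * ‖s.1 0‖) ^ 2 ↔ t ≤ ‖s.1 0‖ ^ 2 := by
      rw [mul_pow, mul_comm]
      exact mul_le_mul_iff_right₀ (by positivity)
    simp only [norm_smul, PiLp.smul_apply, Real.norm_eq_abs, abs_of_pos hr, hs, h1, Set.indicator,
      Set.mem_ofPred_eq, mul_one, Pi.one_apply, ite_mul, one_mul, zero_mul]
  set C := ∫ r : Set.Ioi (0 : ℝ), Real.exp (-(r : ℝ) ^ 2) ∂Measure.volumeIoiPow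
        (Module.finrank ℝ (EuclideanSpace ℂ (Fin (m + 1))) - 1)
  set S := (volume : Measure (EuclideanSpace ℂ (Fin (m + 1)))).toSphere with hS
  have h0 : S.real Set.univ * C = c := by
    have := hpolar 0
    rw [hcone 0 le_rfl one_pos] at this
    have hu : {l : UnitVec (m + 1) | 0 ≤ ‖l.1 0‖ ^ 2} = Set.univ :=
      Set.eq_univ_of_forall fun l => by simp only [Set.mem_ofPred_eq]; positivity
    rw [hu] at this
    simpa using this.symm
  have ht := hpolar t
  rw [hcone t ht0 ht1] at ht
  have hC : C ≠ 0 := fun h => hc.ne (by simpa [h] using h0)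
  have hS0 : S.real Set.univ ≠ 0 := fun h => hc.ne (by simpa [h] using h0)
  have hred : (uniformUnitVec (m + 1)).real {l | t ≤ ‖l.1 0‖ ^ 2} =
      (S.real Set.univ)⁻¹ * S.real {l | t ≤ ‖l.1 0‖ ^ 2} := by
    simp [uniformUnitVec, Measure.real, ← hS]
  rw [hred, inv_mul_eq_iff_eq_mul₀ hS0]
  refine mul_right_cancel₀ hC ?_
  rw [← ht, ← h0]
  ring

/-- Monotonicity bounds this tail by $(1-s)^m$ for every $s<1$. For $m=0$ the claim fails at $t=1$,
as the only coordinate has modulus 1. -/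
theorem uniformUnitVec_real_tail_of_one_le {m : ℕ} (hm : m ≠ 0) {t : ℝ} (ht : 1 ≤ t) :
    (uniformUnitVec (m + 1)).real {l | t ≤ ‖l.1 0‖ ^ 2} = 0 := by
  refine le_antisymm ?_ measureReal_nonneg
  have htend : Filter.Tendsto (fun s : ℝ => (1 - s) ^ m) (nhdsWithin 1 (Set.Iio 1)) (nhds 0) := by
    have : Filter.Tendsto (fun s : ℝ => (1 - s) ^ m) (nhds 1) (nhds ((1 - 1) ^ m)) :=
      Continuous.tendsto (by fun_prop) 1
    rw [sub_self, zero_pow hm] at this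
    exact this.mono_left nhdsWithin_le_nhds
  refine ge_of_tendsto htend ?_
  filter_upwards [Ioo_mem_nhdsLT (zero_lt_one' ℝ)] with s hs
  rw [← uniformUnitVec_real_tail hs.1.le hs.2]
  exact measureReal_mono fun l hl => (hs.2.le.trans ht).trans hl

/-- The squared modulus of a coordinate of a uniform unit vector of `ℂ^(m+1)` follows the beta
distribution with parameters `1` and `m`. -/
theorem map_norm_sq_uniformUnitVec {m : ℕ} (hm : m ≠ 0) :
    (uniformUnitVec (m + 1)).map (fun l => ‖l.1 0‖ ^ 2) =
      (volume.restrict (Set.Ioc (0 : ℝ) 1)).withDensity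
        fun q => ENNReal.ofReal (m * (1 - q) ^ (m - 1)) := by
  have hmeas : Measurable fun l : UnitVec (m + 1) => ‖l.1 0‖ ^ 2 :=
    ((continuous_unitVec_apply 0).norm.pow 2).measurable
  have hdens : ∀ t : ℝ, 0 ≤ t → t ≤ 1 → ∫⁻ q in Set.Ioc t 1, ENNReal.ofReal (m * (1 - q) ^ (m - 1)) =
      ENNReal.ofReal ((1 - t) ^ m) := by
    intro t _ ht1
    rw [← ofReal_integral_eq_lintegral_ofReal, ← intervalIntegral.integral_of_le ht1]
    · congr 1
      rw [intervalIntegral.integral_eq_sub_of_hasDerivAt (f := fun q : ℝ => -(1 - q) ^ m)]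
      · simp [hm]
      · intro q _
        have := (((hasDerivAt_id q).const_sub 1).pow m).neg
        refine HasDerivAt.congr_deriv this ?_
        simp
      · exact Continuous.intervalIntegrable (by fun_prop) _ _
    · exact (Continuous.integrableOn_Icc (by fun_prop)).mono_set Set.Ioc_subset_Icc_self
    · filter_upwards [ae_restrict_mem measurableSet_Ioc] with q hq
      have : 0 ≤ 1 - q := by linarith [hq.2]
      exact mul_nonneg (Nat.cast_nonneg _) (pow_nonneg this _)
  refine Measure.ext_of_Ici _ _ fun t => ?_
  rw [Measure.map_apply hmeas measurableSet_Ici, withDensity_apply _ measurableSet_Ici,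
    Measure.restrict_restrict measurableSet_Ici, ← ofReal_measureReal]
  have hpre : (fun l : UnitVec (m + 1) => ‖l.1 0‖ ^ 2) ⁻¹' Set.Ici t = {l | t ≤ ‖l.1 0‖ ^ 2} := rfl
  rw [hpre]
  rcases le_or_gt 1 t with h1 | h1
  · rw [uniformUnitVec_real_tail_of_one_le hm h1]
    have : (volume.restrict (Set.Ici t ∩ Set.Ioc 0 1)) = 0 := by
      rw [Measure.restrict_eq_zero]
      refine measure_mono_null (t := {1}) (fun q hq => ?_) (by simp)
      exact le_antisymm hq.2.2 (h1.trans hq.1)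
    simp [this]
  · rcases le_or_gt t 0 with h0 | h0
    · have hu : {l : UnitVec (m + 1) | t ≤ ‖l.1 0‖ ^ 2} = {l | 0 ≤ ‖l.1 0‖ ^ 2} := by
        ext l
        have : 0 ≤ ‖l.1 0‖ ^ 2 := by positivity
        simp only [Set.mem_ofPred_eq, this, iff_true]
        exact h0.trans this
      have hi : Set.Ici t ∩ Set.Ioc 0 1 = Set.Ioc 0 1 :=
        Set.inter_eq_right.2 fun q hq => h0.trans hq.1.le
      rw [hu, uniformUnitVec_real_tail le_rfl one_pos, hi, hdens 0 le_rfl zero_le_one]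
    · have hi : (Set.Ici t ∩ Set.Ioc 0 1 : Set ℝ) =ᵐ[volume] (Set.Ioc t 1 : Set ℝ) := by
        have : Set.Ici t ∩ Set.Ioc 0 1 = Set.Icc t 1 := by
          ext q
          exact ⟨fun h => ⟨h.1, h.2.2⟩, fun h => ⟨h.1, h0.trans_le h.1, h.2⟩⟩
        rw [this]
        exact Ioc_ae_eq_Icc.symm
      rw [uniformUnitVec_real_tail h0.le h1, Measure.restrict_congr_set hi, hdens t h0.le h1.le]

theorem integral_comp_norm_sq_uniformUnitVec {m : ℕ} (hm : m ≠ 0) {h : ℝ → ℝ} (hh : Measurable h) :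
    ∫ l, h (‖l.1 0‖ ^ 2) ∂uniformUnitVec (m + 1) =
      ∫ q in (0 : ℝ)..1, m * (1 - q) ^ (m - 1) * h q := by
  have hmeas : Measurable fun l : UnitVec (m + 1) => ‖l.1 0‖ ^ 2 :=
    ((continuous_unitVec_apply 0).norm.pow 2).measurable
  rw [← integral_map (φ := fun l : UnitVec (m + 1) => ‖l.1 0‖ ^ 2) hmeas.aemeasurable
    hh.aestronglyMeasurable, map_norm_sq_uniformUnitVec hm,
    integral_withDensity_eq_integral_toReal_smul (by fun_prop)
      (Filter.Eventually.of_forall fun _ => ENNReal.ofReal_lt_top),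
    intervalIntegral.integral_of_le zero_le_one]
  refine setIntegral_congr_fun measurableSet_Ioc fun q hq => ?_
  have : 0 ≤ 1 - q := by linarith [hq.2]
  simp only [smul_eq_mul]
  rw [ENNReal.toReal_ofReal (mul_nonneg (Nat.cast_nonneg _) (pow_nonneg this _))]

/-! ### Moments of the clipped overlap -/

/-- The overlap function `q ↦ q Θ(q - 1/d)` of Barrett's model. -/
def clip (d : ℕ) (q : ℝ) : ℝ := if 1 / (d : ℝ) ≤ q then q else 0

theorem measurable_clip (d : ℕ) : Measurable (clip d) :=
  Measurable.ite measurableSet_Ici measurable_id measurable_const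

theorem clip_nonneg {d : ℕ} {q : ℝ} (hq : 0 ≤ q) : 0 ≤ clip d q := by
  unfold clip
  split_ifs
  exacts [hq, le_rfl]

theorem clip_le {d : ℕ} {q : ℝ} (hq : 0 ≤ q) : clip d q ≤ q := by
  unfold clip
  split_ifs
  exacts [le_rfl, hq]

theorem intervalIntegral_mul_clip (m : ℕ) {f : ℝ → ℝ} :
    ∫ q in (0 : ℝ)..1, f q * clip (m + 1) q =
      ∫ q in (1 / ((m + 1 : ℕ) : ℝ))..1, f q * q := by
  have hd : 1 / ((m + 1 : ℕ) : ℝ) ≤ 1 := by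
    rw [div_le_one (by positivity)]
    exact_mod_cast Nat.succ_pos m
  have hd0 : 0 < 1 / ((m + 1 : ℕ) : ℝ) := by positivity
  rw [intervalIntegral.integral_of_le zero_le_one, intervalIntegral.integral_of_le hd,
    ← integral_Icc_eq_integral_Ioc, ← integral_Icc_eq_integral_Ioc,
    ← integral_indicator measurableSet_Icc, ← integral_indicator measurableSet_Icc]
  congr 1
  ext q
  by_cases h : 1 / ((m + 1 : ℕ) : ℝ) ≤ q
  · simp only [Set.indicator, Set.mem_Icc, clip, h, hd0.le.trans h, true_and, if_true]
  · simp only [Set.indicator, Set.mem_Icc, clip, h, false_and, if_false, mul_zero, ite_self]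

theorem integral_beta_mul_clip {m : ℕ} (hm : m ≠ 0) :
    ∫ q in (0 : ℝ)..1, m * (1 - q) ^ (m - 1) * clip (m + 1) q =
      (m / (m + 1) : ℝ) ^ m / (m + 1) + (m / (m + 1) : ℝ) ^ (m + 1) / (m + 1) := by
  have hm1 : (m : ℝ) + 1 ≠ 0 := by positivity
  rw [intervalIntegral_mul_clip, intervalIntegral.integral_eq_sub_of_hasDerivAt
    -- Primitive found by integrating by parts against $-(1-q)^m$; it vanishes at $q=1$, and at the
    -- cut-off $1-q=m/(m+1)$.
    (f := fun q : ℝ => -(q * (1 - q) ^ m) - (1 - q) ^ (m + 1) / (m + 1))]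
  · have : 1 - 1 / ((m + 1 : ℕ) : ℝ) = m / (m + 1) := by
      push_cast
      field_simp
      ring
    simp only [this]
    simp [hm]
    field_simp
    ring
  · intro q _
    have h1 := ((hasDerivAt_id q).const_sub 1).pow m
    have h2 := ((hasDerivAt_id q).const_sub 1).pow (m + 1)
    refine HasDerivAt.congr_deriv (((hasDerivAt_id q).mul h1).neg.sub (h2.div_const _)) ?_
    simp
    field_simp
    ring
  · exact Continuous.intervalIntegrable (by fun_prop) _ _

theorem integral_beta_mul_clip_mul {m : ℕ} (hm : m ≠ 0) :
    ∫ q in (0 : ℝ)..1, m * (1 - q) ^ (m - 1) * (clip (m + 1) q * q) =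
      (m / (m + 1) : ℝ) ^ m / (m + 1) ^ 2 + 2 * ((m / (m + 1) : ℝ) ^ (m + 1) / (m + 1) ^ 2 +
        (m / (m + 1) : ℝ) ^ (m + 2) / ((m + 1) * (m + 2))) := by
  have hm1 : (m : ℝ) + 1 ≠ 0 := by positivity
  have hm2 : (m : ℝ) + 2 ≠ 0 := by positivity
  have hswap : ∀ q : ℝ, m * (1 - q) ^ (m - 1) * (clip (m + 1) q * q) =
      m * (1 - q) ^ (m - 1) * q * clip (m + 1) q := fun q => by ring
  simp_rw [hswap]
  rw [intervalIntegral_mul_clip, intervalIntegral.integral_eq_sub_of_hasDerivAt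
    -- The same integration by parts, done twice.
    (f := fun q : ℝ => -(q ^ 2 * (1 - q) ^ m) - 2 * (q * ((1 - q) ^ (m + 1) / (m + 1)) +
      (1 - q) ^ (m + 2) / ((m + 1) * (m + 2))))]
  · have : 1 - 1 / ((m + 1 : ℕ) : ℝ) = m / (m + 1) := by
      push_cast
      field_simp
      ring
    simp only [this]
    simp [hm]
    field_simp
    ring
  · intro q _
    have h1 := ((hasDerivAt_id q).const_sub 1).pow m
    have h2 := ((hasDerivAt_id q).const_sub 1).pow (m + 1)
    have h3 := ((hasDerivAt_id q).const_sub 1).pow (m + 2)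
    refine HasDerivAt.congr_deriv ((((hasDerivAt_id q).pow 2).mul h1).neg.sub
      ((((hasDerivAt_id q).mul (h2.div_const _)).add (h3.div_const _)).const_mul 2)) ?_
    simp
    field_simp
    ring
  · exact Continuous.intervalIntegrable (by fun_prop) _ _

/-! ### Weighted second moments of a uniform unit vector -/

theorem overlap_nonneg {d : ℕ} (v l : UnitVec d) : 0 ≤ overlap v l := sq_nonneg _

theorem overlap_le_one {d : ℕ} (v l : UnitVec d) : overlap v l ≤ 1 := by
  have h := norm_inner_le_norm (𝕜 := ℂ) v.1 l.1
  rw [norm_unitVec, norm_unitVec, one_mul] at h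
  exact pow_le_one₀ (norm_nonneg _) h

theorem continuous_overlap {d : ℕ} (v : UnitVec d) : Continuous (overlap v) := by
  unfold overlap
  fun_prop

theorem norm_unitVec_apply_le {d : ℕ} (l : UnitVec d) (i : Fin d) : ‖l.1 i‖ ≤ 1 :=
  (PiLp.norm_apply_le l.1 i).trans (norm_unitVec l).le

theorem continuous_ketbra_apply {d : ℕ} (i j : Fin d) :
    Continuous fun l : UnitVec d => ketbra l i j := by
  simp only [ketbra, Matrix.of_apply]
  exact (continuous_unitVec_apply i).mul (continuous_unitVec_apply j).star

theorem norm_ketbra_apply_le {d : ℕ} (l : UnitVec d) (i j : Fin d) : ‖ketbra l i j‖ ≤ 1 := by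
  simp only [ketbra, Matrix.of_apply, norm_mul, norm_star]
  exact mul_le_one₀ (norm_unitVec_apply_le l i) (norm_nonneg _) (norm_unitVec_apply_le l j)

theorem integrable_mul_ketbra {d : ℕ} {f : UnitVec d → ℝ} (hf : Measurable f)
    (hb : ∀ l, |f l| ≤ 1) (i j : Fin d) :
    Integrable (fun l => (f l : ℂ) * ketbra l i j) (uniformUnitVec d) := by
  refine Integrable.of_bound ((Complex.measurable_ofReal.comp hf).mul
    (continuous_ketbra_apply i j).measurable).aestronglyMeasurable 1 ?_
  refine Filter.Eventually.of_forall fun l => ?_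
  rw [norm_mul, Complex.norm_real, Real.norm_eq_abs]
  exact mul_le_one₀ (hb l) (norm_nonneg _) (norm_ketbra_apply_le l i j)

/-- Flipping the sign of one coordinate. -/
def signFlip {d : ℕ} (a : Fin d) :
    EuclideanSpace ℂ (Fin d) ≃ₗᵢ[ℝ] EuclideanSpace ℂ (Fin d) :=
  LinearIsometryEquiv.piLpCongrRight 2 fun i =>
    if i = a then LinearIsometryEquiv.neg ℝ else LinearIsometryEquiv.refl ℝ ℂ

theorem signFlip_apply {d : ℕ} (a i : Fin d) (x : EuclideanSpace ℂ (Fin d)) :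
    signFlip a x i = if i = a then -x i else x i := by
  rw [signFlip, LinearIsometryEquiv.piLpCongrRight_apply]
  dsimp only
  split_ifs <;> simp

/-- Exchanging two coordinates. -/
def coordSwap {d : ℕ} (a b : Fin d) :
    EuclideanSpace ℂ (Fin d) ≃ₗᵢ[ℝ] EuclideanSpace ℂ (Fin d) :=
  LinearIsometryEquiv.piLpCongrLeft 2 ℝ ℂ (Equiv.swap a b)

theorem coordSwap_apply {d : ℕ} (a b i : Fin d) (x : EuclideanSpace ℂ (Fin d)) :
    coordSwap a b x i = x (Equiv.swap a b i) := by
  rw [coordSwap, LinearIsometryEquiv.piLpCongrLeft_apply]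
  rfl

/-- Flipping the sign of coordinate `a` preserves the measure and the weight but negates the
integrand. -/
theorem integral_ketbra_offDiag {m : ℕ} (h : ℝ → ℝ) {a b : Fin (m + 1)} (hab : a ≠ b) :
    ∫ l, (h (‖l.1 0‖ ^ 2) : ℂ) * ketbra l a b ∂uniformUnitVec (m + 1) = 0 := by
  have h1 := integral_comp_sphereMap (signFlip a)
    fun l : UnitVec (m + 1) => (h (‖l.1 0‖ ^ 2) : ℂ) * ketbra l a b
  have h2 : ∀ l : UnitVec (m + 1), (h (‖(sphereMap (signFlip a) l).1 0‖ ^ 2) : ℂ) *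
      ketbra (sphereMap (signFlip a) l) a b = -((h (‖l.1 0‖ ^ 2) : ℂ) * ketbra l a b) := by
    intro l
    have h0 : ‖(sphereMap (signFlip a) l).1 0‖ = ‖l.1 0‖ := by
      rw [sphereMap, signFlip_apply]
      split_ifs <;> simp
    rw [h0]
    simp [ketbra, sphereMap, signFlip_apply, hab.symm]
  simp_rw [h2] at h1
  rw [integral_neg] at h1
  exact self_eq_neg.1 h1.symm

theorem ketbra_apply_self {d : ℕ} (l : UnitVec d) (a : Fin d) :
    ketbra l a a = ((‖l.1 a‖ ^ 2 : ℝ) : ℂ) := by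
  simp [ketbra, Complex.mul_conj, Complex.normSq_eq_norm_sq]

theorem integral_ketbra_diag_eq {m : ℕ} (h : ℝ → ℝ) {a b : Fin (m + 1)} (ha : a ≠ 0) (hb : b ≠ 0) :
    ∫ l, h (‖l.1 0‖ ^ 2) * ‖l.1 a‖ ^ 2 ∂uniformUnitVec (m + 1) =
      ∫ l, h (‖l.1 0‖ ^ 2) * ‖l.1 b‖ ^ 2 ∂uniformUnitVec (m + 1) := by
  rw [← integral_comp_sphereMap (coordSwap a b)
    fun l : UnitVec (m + 1) => h (‖l.1 0‖ ^ 2) * ‖l.1 b‖ ^ 2]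
  simp only [sphereMap, coordSwap_apply, Equiv.swap_apply_right,
    Equiv.swap_apply_of_ne_of_ne ha.symm hb.symm]

/-- The squared moduli sum to 1, and the $m$ coordinates other than 0 contribute equally because
they can be exchanged. -/
theorem integral_ketbra_diag {m : ℕ} {h : ℝ → ℝ} (hh : Measurable h)
    (hb : ∀ q ∈ Set.Icc (0 : ℝ) 1, |h q| ≤ 1) {a : Fin (m + 1)} (ha : a ≠ 0) :
    m * ∫ l, h (‖l.1 0‖ ^ 2) * ‖l.1 a‖ ^ 2 ∂uniformUnitVec (m + 1) =
      ∫ l, h (‖l.1 0‖ ^ 2) ∂uniformUnitVec (m + 1) -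
        ∫ l, h (‖l.1 0‖ ^ 2) * ‖l.1 0‖ ^ 2 ∂uniformUnitVec (m + 1) := by
  have hint : ∀ i : Fin (m + 1), Integrable (fun l : UnitVec (m + 1) =>
      h (‖l.1 0‖ ^ 2) * ‖l.1 i‖ ^ 2) (uniformUnitVec (m + 1)) := by
    intro i
    refine Integrable.of_bound ((hh.comp ((continuous_unitVec_apply 0).norm.pow 2).measurable).mul
      ((continuous_unitVec_apply i).norm.pow 2).measurable).aestronglyMeasurable 1 ?_
    refine Filter.Eventually.of_forall fun l => ?_
    have h1 : ∀ i, ‖l.1 i‖ ^ 2 ≤ 1 := fun i =>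
      pow_le_one₀ (norm_nonneg _) (norm_unitVec_apply_le l i)
    rw [Real.norm_eq_abs, abs_mul]
    refine mul_le_one₀ (hb _ ⟨by positivity, h1 0⟩) (abs_nonneg _) ?_
    rw [abs_of_nonneg (by positivity)]
    exact h1 i
  have hsum : ∫ l, h (‖l.1 0‖ ^ 2) ∂uniformUnitVec (m + 1) =
      ∑ i, ∫ l, h (‖l.1 0‖ ^ 2) * ‖l.1 i‖ ^ 2 ∂uniformUnitVec (m + 1) := by
    rw [← integral_finsetSum _ fun i _ => hint i]
    congr 1
    ext l
    rw [← Finset.mul_sum, sum_norm_sq_unitVec, mul_one]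
  rw [hsum, Fin.sum_univ_succ,
    Finset.sum_congr rfl fun i _ => integral_ketbra_diag_eq h (Fin.succ_ne_zero i) ha]
  simp

theorem exists_orthonormalBasis_zero_eq {m : ℕ} (v : UnitVec (m + 1)) :
    ∃ b : OrthonormalBasis (Fin (m + 1)) ℂ (EuclideanSpace ℂ (Fin (m + 1))), b 0 = v.1 := by
  have hv : Orthonormal ℂ (({0} : Set (Fin (m + 1))).domRestrict fun _ => v.1) := by
    constructor
    · intro i
      exact norm_unitVec v
    · intro i j hij
      exact absurd (Subsingleton.elim i j) hij
  obtain ⟨b, hb⟩ := hv.exists_orthonormalBasis_extension_of_card_eq (by simp)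
  exact ⟨b, hb 0 rfl⟩

/-- The isometry that carries the standard basis to a given orthonormal basis. -/
def basisIsometry {d : ℕ} (b : OrthonormalBasis (Fin d) ℂ (EuclideanSpace ℂ (Fin d))) :
    EuclideanSpace ℂ (Fin d) ≃ₗᵢ[ℝ] EuclideanSpace ℂ (Fin d) :=
  ⟨b.repr.symm.toLinearEquiv.restrictScalars ℝ, b.repr.symm.norm_map⟩

theorem basisIsometry_apply {d : ℕ} (b : OrthonormalBasis (Fin d) ℂ (EuclideanSpace ℂ (Fin d)))
    (x : EuclideanSpace ℂ (Fin d)) (i : Fin d) :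
    basisIsometry b x i = ∑ a, x a * b a i := by
  change b.repr.symm x i = _
  rw [← b.sum_repr_symm x]
  simp

theorem inner_basisIsometry {d : ℕ} (b : OrthonormalBasis (Fin d) ℂ (EuclideanSpace ℂ (Fin d)))
    (x : EuclideanSpace ℂ (Fin d)) (a : Fin d) :
    inner ℂ (b a) (basisIsometry b x) = x a := by
  change inner ℂ (b a) (b.repr.symm x) = _
  rw [← b.repr_apply_apply, LinearIsometryEquiv.apply_symm_apply]

theorem sum_orthonormalBasis_mul_star {d : ℕ}
    (b : OrthonormalBasis (Fin d) ℂ (EuclideanSpace ℂ (Fin d))) (i j : Fin d) :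
    ∑ a, b a i * star (b a j) = if i = j then 1 else 0 := by
  have := b.sum_inner_mul_inner (EuclideanSpace.single i 1) (EuclideanSpace.single j 1)
  simpa [EuclideanSpace.inner_single_left, EuclideanSpace.inner_single_right, Pi.single_apply,
    eq_comm (a := j)] using this

/-- By invariance, `v` may be rotated to the first basis vector. -/
theorem integral_comp_overlap {m : ℕ} (v : UnitVec (m + 1)) (h : ℝ → ℝ) :
    ∫ l, h (overlap v l) ∂uniformUnitVec (m + 1) =
      ∫ l, h (‖l.1 0‖ ^ 2) ∂uniformUnitVec (m + 1) := by
  obtain ⟨b, hb⟩ := exists_orthonormalBasis_zero_eq v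
  rw [← integral_comp_sphereMap (basisIsometry b)]
  simp only [overlap, ← hb, sphereMap, inner_basisIsometry]

/-- The second moments of a uniform unit vector, weighted by a function of the overlap with a fixed
unit vector. -/
theorem integral_comp_overlap_mul_ketbra {m : ℕ} (hm : m ≠ 0) (v : UnitVec (m + 1)) {h : ℝ → ℝ}
    (hh : Measurable h) (hb : ∀ q ∈ Set.Icc (0 : ℝ) 1, |h q| ≤ 1) {I₀ I₁ : ℝ}
    (hI₀ : ∫ l, h (‖l.1 0‖ ^ 2) ∂uniformUnitVec (m + 1) = I₀)
    (hI₁ : ∫ l, h (‖l.1 0‖ ^ 2) * ‖l.1 0‖ ^ 2 ∂uniformUnitVec (m + 1) = I₁) (i j : Fin (m + 1)) :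
    ∫ l, (h (overlap v l) : ℂ) * ketbra l i j ∂uniformUnitVec (m + 1) =
      ((I₁ - (I₀ - I₁) / m : ℝ) : ℂ) * ketbra v i j +
        (((I₀ - I₁) / m : ℝ) : ℂ) * (1 : Matrix (Fin (m + 1)) (Fin (m + 1)) ℂ) i j := by
  obtain ⟨b, hbv⟩ := exists_orthonormalBasis_zero_eq v
  have hm' : (m : ℝ) ≠ 0 := Nat.cast_ne_zero.2 hm
  have hmeas : Measurable fun l : UnitVec (m + 1) => h (‖l.1 0‖ ^ 2) :=
    hh.comp ((continuous_unitVec_apply 0).norm.pow 2).measurable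
  have hbound : ∀ l : UnitVec (m + 1), |h (‖l.1 0‖ ^ 2)| ≤ 1 := fun l =>
    hb _ ⟨by positivity, pow_le_one₀ (norm_nonneg _) (norm_unitVec_apply_le l 0)⟩
  have hint := integrable_mul_ketbra hmeas hbound
  -- Written as a constant plus a spike at `a = 0`: after the change of basis the constant resums to
  -- the identity by completeness, the spike to `ketbra v`.
  have hdiag : ∀ a : Fin (m + 1),
      ∫ l, (h (‖l.1 0‖ ^ 2) : ℂ) * ketbra l a a ∂uniformUnitVec (m + 1) =
        (((I₀ - I₁) / m : ℝ) : ℂ) + if a = 0 then ((I₁ - (I₀ - I₁) / m : ℝ) : ℂ) else 0 := by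
    intro a
    simp_rw [ketbra_apply_self, ← Complex.ofReal_mul]
    rw [integral_complex_ofReal]
    split_ifs with ha
    · rw [ha, hI₁, ← Complex.ofReal_add]
      congr 1
      ring
    · rw [add_zero, ← hI₀, ← hI₁, ← integral_ketbra_diag hh hb ha]
      congr 1
      field_simp
  rw [← integral_comp_sphereMap (basisIsometry b)]
  have hexp : ∀ l : UnitVec (m + 1), (h (overlap v (sphereMap (basisIsometry b) l)) : ℂ) *
      ketbra (sphereMap (basisIsometry b) l) i j =
      ∑ a, ∑ c, (b a i * star (b c j)) * ((h (‖l.1 0‖ ^ 2) : ℂ) * ketbra l a c) := by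
    intro l
    simp only [overlap, ← hbv, sphereMap, inner_basisIsometry, ketbra, Matrix.of_apply,
      basisIsometry_apply, star_sum]
    rw [Finset.sum_mul_sum]
    simp only [Finset.mul_sum, star_mul']
    refine Finset.sum_congr rfl fun a _ => Finset.sum_congr rfl fun c _ => ?_
    ring
  simp_rw [hexp]
  rw [integral_finsetSum _ fun a _ => integrable_finsetSum _ fun c _ => (hint a c).const_mul _]
  have hrow : ∀ a : Fin (m + 1), ∫ l, ∑ c, (b a i * star (b c j)) *
      ((h (‖l.1 0‖ ^ 2) : ℂ) * ketbra l a c) ∂uniformUnitVec (m + 1) =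
      (b a i * star (b a j)) * ((((I₀ - I₁) / m : ℝ) : ℂ) +
        if a = 0 then ((I₁ - (I₀ - I₁) / m : ℝ) : ℂ) else 0) := by
    intro a
    rw [integral_finsetSum _ fun c _ => (hint a c).const_mul _, Finset.sum_eq_single a]
    · rw [integral_const_mul, hdiag]
    · intro c _ hc
      rw [integral_const_mul, integral_ketbra_offDiag h hc.symm, mul_zero]
    · simp
  simp only [hrow, mul_add, mul_ite, mul_zero, Finset.sum_add_distrib, Finset.sum_ite_eq',
    Finset.mem_univ, if_true, ← Finset.sum_mul, sum_orthonormalBasis_mul_star, hbv]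
  simp only [ketbra, Matrix.of_apply, Matrix.one_apply]
  ring

/-! ### The threshold constant -/

theorem barrettBound_succ (m : ℕ) :
    barrettBound (m + 1) = (3 * m + 2) / (m + 2) * m ^ m * ((m + 1 : ℝ) ^ (m + 1))⁻¹ := by
  unfold barrettBound
  push_cast
  rw [add_sub_cancel_right, add_assoc (m : ℝ) 1 1, one_add_one_eq_two]
  congr 3
  ring

/-- The second moments of a uniform unit vector on the acceptance region of Barrett's model. -/
theorem exists_integral_clip_mul_ketbra {m : ℕ} (hm : m ≠ 0) :
    ∃ β : ℝ, ∀ v : UnitVec (m + 1),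
      ∫ l, clip (m + 1) (overlap v l) ∂uniformUnitVec (m + 1) =
        barrettBound (m + 1) / (m + 1) + (m + 1) * β ∧
      ∀ i j, ∫ l, (clip (m + 1) (overlap v l) : ℂ) * ketbra l i j ∂uniformUnitVec (m + 1) =
        ((barrettBound (m + 1) / (m + 1) : ℝ) : ℂ) * ketbra v i j +
          (β : ℂ) * (1 : Matrix (Fin (m + 1)) (Fin (m + 1)) ℂ) i j := by
  have hmeas := measurable_clip (m + 1)
  have hI₀ := integral_comp_norm_sq_uniformUnitVec hm hmeas
  have hI₁ := integral_comp_norm_sq_uniformUnitVec hm (hmeas.mul measurable_id)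
  rw [integral_beta_mul_clip hm] at hI₀
  simp only [Pi.mul_apply, id] at hI₁
  rw [integral_beta_mul_clip_mul hm] at hI₁
  have hb : ∀ q ∈ Set.Icc (0 : ℝ) 1, |clip (m + 1) q| ≤ 1 := fun q hq => by
    rw [abs_of_nonneg (clip_nonneg hq.1)]
    exact (clip_le hq.1).trans hq.2
  set I₀ : ℝ := (m / (m + 1) : ℝ) ^ m / (m + 1) + (m / (m + 1) : ℝ) ^ (m + 1) / (m + 1)
  set I₁ : ℝ := (m / (m + 1) : ℝ) ^ m / (m + 1) ^ 2 +
    2 * ((m / (m + 1) : ℝ) ^ (m + 1) / (m + 1) ^ 2 +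
        (m / (m + 1) : ℝ) ^ (m + 2) / ((m + 1) * (m + 2)))
  have hm' : (m : ℝ) ≠ 0 := Nat.cast_ne_zero.2 hm
  have hm1 : (m : ℝ) + 1 ≠ 0 := by positivity
  have hm2 : (m : ℝ) + 2 ≠ 0 := by positivity
  -- The identity that singles out the threshold: the coefficient of `ketbra v` is $\alpha^\ast/d$.
  have hA : I₁ - (I₀ - I₁) / m = barrettBound (m + 1) / (m + 1) := by
    simp only [I₀, I₁, barrettBound_succ, div_pow, pow_succ]
    field_simp
    ring
  refine ⟨(I₀ - I₁) / m, fun v => ⟨?_, fun i j => ?_⟩⟩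
  · rw [integral_comp_overlap, hI₀, ← hA]
    field_simp
    ring
  · rw [integral_comp_overlap_mul_ketbra hm v hmeas hb hI₀ hI₁, hA]

theorem integral_ketbra {m : ℕ} (hm : m ≠ 0) (i j : Fin (m + 1)) :
    ∫ l, ketbra l i j ∂uniformUnitVec (m + 1) =
      ((m + 1 : ℝ) : ℂ)⁻¹ * (1 : Matrix (Fin (m + 1)) (Fin (m + 1)) ℂ) i j := by
  have := isProbabilityMeasure_uniformUnitVec (Nat.succ_pos m)
  have hm' : (m : ℝ) ≠ 0 := Nat.cast_ne_zero.2 hm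
  have hm1 : (m : ℝ) + 1 ≠ 0 := by positivity
  have hI₁ : ∫ l, (fun _ : ℝ => (1 : ℝ)) (‖l.1 0‖ ^ 2) * ‖l.1 0‖ ^ 2 ∂uniformUnitVec (m + 1) =
      (m + 1 : ℝ)⁻¹ := by
    have h0 := integral_comp_norm_sq_uniformUnitVec hm measurable_id
    simp only [id] at h0
    simp only [one_mul]
    rw [h0,
      intervalIntegral.integral_eq_sub_of_hasDerivAt
      (f := fun q : ℝ => -(q * (1 - q) ^ m) - (1 - q) ^ (m + 1) / (m + 1))]
    · simp [hm]
    · intro q _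
      have h1 := ((hasDerivAt_id q).const_sub 1).pow m
      have h2 := ((hasDerivAt_id q).const_sub 1).pow (m + 1)
      refine HasDerivAt.congr_deriv (((hasDerivAt_id q).mul h1).neg.sub (h2.div_const _)) ?_
      simp
      field_simp
      ring
    · exact Continuous.intervalIntegrable (by fun_prop) _ _
  have h := integral_comp_overlap_mul_ketbra hm
    ⟨EuclideanSpace.single 0 1, by simp⟩ (h := fun _ => (1 : ℝ)) measurable_const (by simp)
    (I₀ := 1) (by simp) hI₁ i j
  have h1 : (1 - (m + 1 : ℝ)⁻¹) / m = (m + 1 : ℝ)⁻¹ := by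
    field_simp
    ring
  simpa only [h1, sub_self, Complex.ofReal_zero, zero_mul, zero_add, Complex.ofReal_one, one_mul,
    Complex.ofReal_inv] using h

/-! ### Rank-one projectors and hidden states -/

theorem overlap_eq_trace {d : ℕ} (v l : UnitVec d) :
    (overlap v l : ℂ) = (ketbra l * ketbra v).trace := by
  have h1 : (overlap v l : ℂ) = inner ℂ v.1 l.1 * star (inner ℂ v.1 l.1) := by
    rw [Complex.star_def, Complex.mul_conj, Complex.normSq_eq_norm_sq, overlap]
  rw [h1, PiLp.inner_apply]
  simp only [Matrix.trace, Matrix.diag, Matrix.mul_apply, ketbra, Matrix.of_apply, star_sum]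
  rw [Finset.sum_mul_sum]
  refine Finset.sum_congr rfl fun i _ => Finset.sum_congr rfl fun j _ => ?_
  simp
  ring

theorem trace_ketbra {d : ℕ} (l : UnitVec d) : (ketbra l).trace = 1 := by
  simp only [Matrix.trace, Matrix.diag, ketbra_apply_self]
  rw [← Complex.ofReal_sum, sum_norm_sq_unitVec, Complex.ofReal_one]

theorem ketbra_isHermitian {d : ℕ} (l : UnitVec d) : (ketbra l).IsHermitian := by
  ext i j
  simp [ketbra, mul_comm]

theorem ketbra_mul_self {d : ℕ} (l : UnitVec d) : ketbra l * ketbra l = ketbra l := by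
  have h : ∑ k, star (l.1 k) * l.1 k = 1 := by
    rw [← trace_ketbra l]
    simp [Matrix.trace, ketbra, mul_comm]
  ext i j
  simp only [Matrix.mul_apply, ketbra, Matrix.of_apply]
  calc ∑ k, l.1 i * star (l.1 k) * (l.1 k * star (l.1 j))
      = l.1 i * (∑ k, star (l.1 k) * l.1 k) * star (l.1 j) := by
        rw [Finset.mul_sum, Finset.sum_mul]
        exact Finset.sum_congr rfl fun k _ => by ring
    _ = _ := by rw [h, mul_one]

theorem isState_hiddenState {d : ℕ} (hd : 2 ≤ d) (l : UnitVec d) : IsState (hiddenState d l) := by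
  have hd' : (0 : ℝ) < (d : ℝ) - 1 := by
    have : (2 : ℝ) ≤ d := by exact_mod_cast hd
    linarith
  constructor
  · rw [hiddenState, ← Complex.ofReal_inv]
    refine Matrix.PosSemidef.smul ?_ (Complex.zero_le_real.2 (inv_pos.2 hd').le)
    -- The complement of a projector is a projector, hence positive.
    have h : (1 - ketbra l) = (1 - ketbra l).conjTranspose * (1 - ketbra l) := by
      rw [Matrix.conjTranspose_sub, Matrix.conjTranspose_one, (ketbra_isHermitian l).eq,
        sub_mul, mul_sub, mul_sub, ketbra_mul_self]
      simp
    rw [h]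
    exact Matrix.posSemidef_conjTranspose_mul_self _
  · rw [hiddenState, Matrix.trace_smul, Matrix.trace_sub, Matrix.trace_one, trace_ketbra,
      Fintype.card_fin, smul_eq_mul]
    push_cast
    refine inv_mul_cancel₀ ?_
    exact_mod_cast hd'.ne'

theorem hiddenState_apply (d : ℕ) (l : UnitVec d) (i j : Fin d) :
    hiddenState d l i j = ((d - 1 : ℝ) : ℂ)⁻¹ *
      ((1 : Matrix (Fin d) (Fin d) ℂ) i j - ketbra l i j) := rfl

theorem continuous_hiddenState_apply (d : ℕ) (i j : Fin d) :
    Continuous fun l : UnitVec d => hiddenState d l i j := by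
  simp only [hiddenState_apply]
  exact continuous_const.mul (continuous_const.sub (continuous_ketbra_apply i j))

theorem integrable_mul_hiddenState {d : ℕ} {f : UnitVec d → ℝ} (hf : Measurable f)
    (hb : ∀ l, |f l| ≤ 1) (i j : Fin d) :
    Integrable (fun l => (f l : ℂ) * hiddenState d l i j) (uniformUnitVec d) := by
  have h1 : Integrable (fun l => (f l : ℂ)) (uniformUnitVec d) :=
    Integrable.of_bound (Complex.measurable_ofReal.comp hf).aestronglyMeasurable 1
      (Filter.Eventually.of_forall fun l => by
        rw [Complex.norm_real, Real.norm_eq_abs]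
        exact hb l)
  refine (((h1.mul_const ((1 : Matrix (Fin d) (Fin d) ℂ) i j)).sub
    (integrable_mul_ketbra hf hb i j)).const_mul ((d - 1 : ℝ) : ℂ)⁻¹).congr
    (Filter.Eventually.of_forall fun l => ?_)
  simp only [hiddenState_apply, Pi.sub_apply]
  ring

theorem integral_mul_hiddenState {d : ℕ} {f : UnitVec d → ℝ} (hf : Measurable f)
    (hb : ∀ l, |f l| ≤ 1) (i j : Fin d) :
    ∫ l, (f l : ℂ) * hiddenState d l i j ∂uniformUnitVec d = ((d - 1 : ℝ) : ℂ)⁻¹ *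
      (((∫ l, f l ∂uniformUnitVec d : ℝ) : ℂ) * (1 : Matrix (Fin d) (Fin d) ℂ) i j -
        ∫ l, (f l : ℂ) * ketbra l i j ∂uniformUnitVec d) := by
  have h1 : Integrable (fun l => (f l : ℂ)) (uniformUnitVec d) :=
    Integrable.of_bound (Complex.measurable_ofReal.comp hf).aestronglyMeasurable 1
      (Filter.Eventually.of_forall fun l => by
        rw [Complex.norm_real, Real.norm_eq_abs]
        exact hb l)
  rw [← integral_complex_ofReal, ← integral_mul_const,
    ← integral_sub (h1.mul_const _) (integrable_mul_ketbra hf hb i j), ← integral_const_mul]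
  congr 1
  ext l
  rw [hiddenState_apply]
  ring

/-! ### Normalisation and positivity of the responses -/

namespace RankOneRefinement

variable {d n : ℕ} {M : POVM (Fin d) n}

theorem sum_label {E : Type*} [AddCommMonoid E] (R : RankOneRefinement M) (f : Fin R.size → E) :
    ∑ a, ∑ k with R.label k = a, f k = ∑ k, f k :=
  Finset.sum_fiberwise _ _ _

theorem sum_weight_smul_ketbra (R : RankOneRefinement M) :
    ∑ k, (R.weight k : ℂ) • ketbra (R.vec k) = 1 := by
  rw [← M.sum_eq_one, ← R.sum_label]
  exact Finset.sum_congr rfl fun a _ => (R.elem_eq a).symm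

theorem trace_elem (R : RankOneRefinement M) (a : Fin n) :
    (M.elem a).trace = ((∑ k with R.label k = a, R.weight k : ℝ) : ℂ) := by
  rw [R.elem_eq, Matrix.trace_sum]
  simp [Matrix.trace_smul, trace_ketbra]

theorem sum_weight (R : RankOneRefinement M) : ∑ k, R.weight k = d := by
  have h := congrArg Matrix.trace R.sum_weight_smul_ketbra
  rw [Matrix.trace_sum, Matrix.trace_one, Fintype.card_fin] at h
  simp only [Matrix.trace_smul, trace_ketbra, smul_eq_mul, mul_one] at h
  exact_mod_cast h

theorem sum_weight_mul_overlap (R : RankOneRefinement M) (l : UnitVec d) :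
    ∑ k, R.weight k * overlap (R.vec k) l = 1 := by
  have h := congrArg (fun X => (ketbra l * X).trace) R.sum_weight_smul_ketbra
  simp only [Finset.mul_sum, Matrix.trace_sum, Matrix.mul_smul, Matrix.trace_smul,
    ← overlap_eq_trace, mul_one, trace_ketbra, smul_eq_mul] at h
  exact_mod_cast h

theorem clipped_eq (R : RankOneRefinement M) (k : Fin R.size) (l : UnitVec d) :
    R.clipped k l = R.weight k * clip d (overlap (R.vec k) l) := by
  unfold clipped clip
  split_ifs <;> simp

theorem clipped_nonneg (R : RankOneRefinement M) (k : Fin R.size) (l : UnitVec d) :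
    0 ≤ R.clipped k l := by
  rw [clipped_eq]
  exact mul_nonneg (R.weight_nonneg k) (clip_nonneg (overlap_nonneg _ _))

/-- Clipping only lowers the Born probabilities, which sum to 1. The deficit is what `response`
redistributes in proportion to the weights. -/
theorem sum_clipped_le_one (R : RankOneRefinement M) (l : UnitVec d) :
    ∑ k, R.clipped k l ≤ 1 := by
  rw [← R.sum_weight_mul_overlap l]
  refine Finset.sum_le_sum fun k _ => ?_
  rw [clipped_eq]
  exact mul_le_mul_of_nonneg_left (clip_le (overlap_nonneg _ _)) (R.weight_nonneg k)

theorem measurable_clip_overlap (d : ℕ) (v : UnitVec d) :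
    Measurable fun l => clip d (overlap v l) :=
  (measurable_clip d).comp (continuous_overlap v).measurable

theorem measurable_clipped (R : RankOneRefinement M) (k : Fin R.size) :
    Measurable (R.clipped k) := by
  have : R.clipped k = fun l => R.weight k * clip d (overlap (R.vec k) l) :=
    funext (R.clipped_eq k)
  rw [this]
  exact (measurable_clip_overlap d _).const_mul _

theorem measurable_response (R : RankOneRefinement M) (a : Fin n) :
    Measurable (R.response a) := by
  unfold response
  exact Finset.measurable_fun_sum _ fun k _ => (R.measurable_clipped k).add
    ((measurable_const.sub (Finset.measurable_fun_sum _ fun k' _ =>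
      R.measurable_clipped k')).const_mul _)

theorem response_nonneg (R : RankOneRefinement M) (a : Fin n) (l : UnitVec d) :
    0 ≤ R.response a l :=
  Finset.sum_nonneg fun k _ => add_nonneg (R.clipped_nonneg k l)
    (mul_nonneg (div_nonneg (R.weight_nonneg k) (Nat.cast_nonneg _))
      (sub_nonneg.2 (R.sum_clipped_le_one l)))

theorem sum_response (hd : d ≠ 0) (R : RankOneRefinement M) (l : UnitVec d) :
    ∑ a, R.response a l = 1 := by
  have hd' : (d : ℝ) ≠ 0 := Nat.cast_ne_zero.2 hd
  simp only [response]
  rw [R.sum_label, Finset.sum_add_distrib, ← Finset.sum_mul, ← Finset.sum_div, R.sum_weight,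
    div_self hd']
  ring

theorem noise_nonneg (R : RankOneRefinement M) (a : Fin n) : 0 ≤ R.noise a :=
  Finset.sum_nonneg fun k _ => div_nonneg (R.weight_nonneg k) (Nat.cast_nonneg _)

theorem sum_noise (hd : d ≠ 0) (R : RankOneRefinement M) : ∑ a, R.noise a = 1 := by
  simp only [noise]
  rw [R.sum_label, ← Finset.sum_div, R.sum_weight, div_self (Nat.cast_ne_zero.2 hd)]

theorem measurable_quantumResponse (R : RankOneRefinement M) (a : Fin n) :
    Measurable (R.quantumResponse a) := by
  unfold quantumResponse
  exact Finset.measurable_fun_sum _ fun k _ =>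
    (measurable_const.sub (continuous_overlap _).measurable).const_mul _

theorem quantumResponse_nonneg (hd : 2 ≤ d) (R : RankOneRefinement M) (a : Fin n)
    (l : UnitVec d) : 0 ≤ R.quantumResponse a l := by
  have hd' : (2 : ℝ) ≤ d := by exact_mod_cast hd
  exact Finset.sum_nonneg fun k _ => mul_nonneg
    (div_nonneg (R.weight_nonneg k) (by linarith)) (sub_nonneg.2 (overlap_le_one _ _))

theorem sum_quantumResponse (hd : 2 ≤ d) (R : RankOneRefinement M) (l : UnitVec d) :
    ∑ a, R.quantumResponse a l = 1 := by
  have hd' : (2 : ℝ) ≤ d := by exact_mod_cast hd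
  have h1 : (d : ℝ) - 1 ≠ 0 := by linarith
  simp only [quantumResponse]
  rw [R.sum_label]
  have : ∀ k, R.weight k / ((d : ℝ) - 1) * (1 - overlap (R.vec k) l) =
      (R.weight k - R.weight k * overlap (R.vec k) l) / ((d : ℝ) - 1) := fun k => by ring
  simp_rw [this]
  rw [← Finset.sum_div, Finset.sum_sub_distrib, R.sum_weight, R.sum_weight_mul_overlap,
    div_self h1]

theorem quantumResponse_eq_trace (R : RankOneRefinement M) (a : Fin n) (l : UnitVec d) :
    (R.quantumResponse a l : ℂ) = (hiddenState d l * M.elem a).trace := by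
  rw [R.elem_eq, Finset.mul_sum, Matrix.trace_sum, quantumResponse, Complex.ofReal_sum]
  refine Finset.sum_congr rfl fun k _ => ?_
  rw [Matrix.mul_smul, Matrix.trace_smul, hiddenState, Matrix.smul_mul, Matrix.trace_smul, sub_mul,
    one_mul, Matrix.trace_sub, trace_ketbra, ← overlap_eq_trace, smul_eq_mul, smul_eq_mul]
  push_cast
  ring

end RankOneRefinement

theorem barrettBound_pos {d : ℕ} (hd : 2 ≤ d) : 0 < barrettBound d := by
  have hd' : (2 : ℝ) ≤ d := by exact_mod_cast hd
  have h1 : 0 < (d : ℝ) - 1 := by linarith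
  have h2 : 0 < 3 * (d : ℝ) - 1 := by linarith
  unfold barrettBound
  positivity

theorem isResponse_barrettResponse {d : ℕ} (hd : 2 ≤ d) {α : ℝ} (hα₀ : 0 ≤ α)
    (hα : α ≤ barrettBound d) (R : (n : ℕ) → (M : POVM (Fin d) n) → RankOneRefinement M) :
    IsResponse (barrettResponse α R) where
  measurable n M a :=
    (((R n M).measurable_response a).const_mul _).add_const _
  nonneg n M a l := by
    have hb := barrettBound_pos hd
    exact add_nonneg (mul_nonneg (div_nonneg hα₀ hb.le) ((R n M).response_nonneg a l))
      (mul_nonneg (sub_nonneg.2 ((div_le_one hb).2 hα)) ((R n M).noise_nonneg a))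
  sum_eq_one n M l := by
    simp only [barrettResponse]
    rw [Finset.sum_add_distrib, ← Finset.mul_sum, ← Finset.mul_sum,
      (R n M).sum_response (by omega), (R n M).sum_noise (by omega)]
    ring

theorem isResponse_barrettQuantumResponse {d : ℕ} (hd : 2 ≤ d)
    (R : (n : ℕ) → (M : POVM (Fin d) n) → RankOneRefinement M) :
    IsResponse (barrettQuantumResponse R) where
  measurable n M a := (R n M).measurable_quantumResponse a
  nonneg n M a l := (R n M).quantumResponse_nonneg hd a l
  sum_eq_one n M l := (R n M).sum_quantumResponse hd l

theorem IsResponse.abs_le_one {d : ℕ} {Λ : Type} [MeasurableSpace Λ]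
    {p : (n : ℕ) → POVM (Fin d) n → Fin n → Λ → ℝ} (hp : IsResponse p) (n : ℕ)
    (M : POVM (Fin d) n) (a : Fin n) (l : Λ) : |p n M a l| ≤ 1 := by
  rw [abs_of_nonneg (hp.nonneg n M a l), ← hp.sum_eq_one n M l]
  exact Finset.single_le_sum (fun b _ => hp.nonneg n M b l) (Finset.mem_univ a)

/-! ### The assemblage prepared by the model -/

theorem integrable_hiddenState {d : ℕ} (i j : Fin d) :
    Integrable (fun l => hiddenState d l i j) (uniformUnitVec d) := by
  have := integrable_mul_hiddenState (d := d) (f := fun _ => 1) measurable_const (by simp) i j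
  simpa using this

theorem integral_hiddenState {m : ℕ} (hm : m ≠ 0) (i j : Fin (m + 1)) :
    ∫ l, hiddenState (m + 1) l i j ∂uniformUnitVec (m + 1) =
      ((m : ℂ) + 1)⁻¹ * (1 : Matrix (Fin (m + 1)) (Fin (m + 1)) ℂ) i j := by
  have := isProbabilityMeasure_uniformUnitVec (Nat.succ_pos m)
  have hm' : (m : ℂ) ≠ 0 := Nat.cast_ne_zero.2 hm
  have hm1 : (m : ℂ) + 1 ≠ 0 := Nat.cast_add_one_ne_zero m
  have h := integral_mul_hiddenState (d := m + 1) (f := fun _ => 1) measurable_const (by simp) i j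
  simp only [Complex.ofReal_one, one_mul, integral_const, probReal_univ, smul_eq_mul, mul_one,
    integral_ketbra hm] at h
  rw [h]
  push_cast
  rw [add_sub_cancel_right]
  field_simp
  ring

/-- The subnormalised states that the threshold response prepares with the hidden states. -/
theorem integral_response_mul_hiddenState {m n : ℕ} (hm : m ≠ 0) {M : POVM (Fin (m + 1)) n}
    (R : RankOneRefinement M) (a : Fin n) (i j : Fin (m + 1)) :
    ∫ l, (R.response a l : ℂ) * hiddenState (m + 1) l i j ∂uniformUnitVec (m + 1) =
      (M.elem a).trace * ((m + 1 : ℝ) : ℂ)⁻¹ ^ 2 * (1 : Matrix (Fin (m + 1)) (Fin (m + 1)) ℂ) i j -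
        ((barrettBound (m + 1) / ((m + 1) * m) : ℝ) : ℂ) * (M.elem a i j -
          (M.elem a).trace * ((m + 1 : ℝ) : ℂ)⁻¹ *
            (1 : Matrix (Fin (m + 1)) (Fin (m + 1)) ℂ) i j) := by
  obtain ⟨β, hβ⟩ := exists_integral_clip_mul_ketbra hm
  have := isProbabilityMeasure_uniformUnitVec (Nat.succ_pos m)
  have hm' : (m : ℂ) ≠ 0 := Nat.cast_ne_zero.2 hm
  have hm1 : (m : ℂ) + 1 ≠ 0 := Nat.cast_add_one_ne_zero m
  have hclip : ∀ v l : UnitVec (m + 1), |clip (m + 1) (overlap v l)| ≤ 1 := fun v l => by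
    rw [abs_of_nonneg (clip_nonneg (overlap_nonneg v l))]
    exact (clip_le (overlap_nonneg v l)).trans (overlap_le_one v l)
  have hmeas := RankOneRefinement.measurable_clip_overlap (m + 1)
  set δ := (1 : Matrix (Fin (m + 1)) (Fin (m + 1)) ℂ) i j with hδ
  set A := barrettBound (m + 1) / (m + 1) with hA
  have hG := integral_hiddenState hm i j
  have hc : ∀ v : UnitVec (m + 1), ∫ l, (clip (m + 1) (overlap v l) : ℂ) *
      hiddenState (m + 1) l i j ∂uniformUnitVec (m + 1) =
        (m : ℂ)⁻¹ * ((A + m * β) * δ - A * ketbra v i j) := by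
    intro v
    rw [integral_mul_hiddenState (hmeas v) (hclip v), (hβ v).1, (hβ v).2, ← hδ]
    push_cast
    rw [add_sub_cancel_right]
    ring
  have hcint : ∀ v : UnitVec (m + 1), Integrable (fun l => (clip (m + 1) (overlap v l) : ℂ) *
      hiddenState (m + 1) l i j) (uniformUnitVec (m + 1)) := fun v =>
    integrable_mul_hiddenState (hmeas v) (hclip v) i j
  have hGint := integrable_hiddenState i j
  have hexp : ∀ l, (R.response a l : ℂ) * hiddenState (m + 1) l i j =
      ∑ k with R.label k = a, ((R.weight k : ℂ) *
        ((clip (m + 1) (overlap (R.vec k) l) : ℂ) * hiddenState (m + 1) l i j) +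
        (R.weight k : ℂ) / (m + 1) * (hiddenState (m + 1) l i j - ∑ k', (R.weight k' : ℂ) *
          ((clip (m + 1) (overlap (R.vec k') l) : ℂ) * hiddenState (m + 1) l i j))) := by
    intro l
    simp only [RankOneRefinement.response, R.clipped_eq, Complex.ofReal_sum, Finset.sum_mul]
    refine Finset.sum_congr rfl fun k _ => ?_
    simp only [← mul_assoc, ← Finset.sum_mul]
    push_cast
    ring
  simp_rw [hexp]
  have hsint : Integrable (fun l => ∑ k', (R.weight k' : ℂ) *
      ((clip (m + 1) (overlap (R.vec k') l) : ℂ) * hiddenState (m + 1) l i j))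
      (uniformUnitVec (m + 1)) := integrable_finsetSum _ fun k' _ => (hcint _).const_mul _
  have hsum : ∑ k, (R.weight k : ℂ) * ketbra (R.vec k) i j = δ := by
    have := congrFun (congrFun R.sum_weight_smul_ketbra i) j
    simpa [Matrix.sum_apply] using this
  have hw : ∑ k, (R.weight k : ℂ) = m + 1 := by
    have := R.sum_weight
    exact_mod_cast this
  -- Summed over all outcomes the projectors resolve the identity, so only a multiple of `δ`
  -- survives.
  have hs : ∫ l, ∑ k', (R.weight k' : ℂ) * ((clip (m + 1) (overlap (R.vec k') l) : ℂ) *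
      hiddenState (m + 1) l i j) ∂uniformUnitVec (m + 1) =
      (m : ℂ)⁻¹ * ((m + 1) * (A + m * β) - A) * δ := by
    rw [integral_finsetSum _ fun k' _ => (hcint _).const_mul _]
    simp_rw [integral_const_mul, hc]
    have : ∀ k, (R.weight k : ℂ) * ((m : ℂ)⁻¹ * ((A + m * β) * δ - A * ketbra (R.vec k) i j)) =
        R.weight k * ((m : ℂ)⁻¹ * (A + m * β) * δ) -
          (m : ℂ)⁻¹ * A * (R.weight k * ketbra (R.vec k) i j) := fun k => by ring
    simp_rw [this]
    rw [Finset.sum_sub_distrib, ← Finset.sum_mul, ← Finset.mul_sum, hsum, hw]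
    ring
  have hdiff : ∀ c : ℂ, Integrable (fun l => c * (hiddenState (m + 1) l i j -
      ∑ k', (R.weight k' : ℂ) * ((clip (m + 1) (overlap (R.vec k') l) : ℂ) *
        hiddenState (m + 1) l i j))) (uniformUnitVec (m + 1)) := fun c =>
    (hGint.sub hsint).const_mul c
  have hterm : ∀ k, Integrable (fun l => (R.weight k : ℂ) *
        ((clip (m + 1) (overlap (R.vec k) l) : ℂ) * hiddenState (m + 1) l i j) +
        (R.weight k : ℂ) / (m + 1) * (hiddenState (m + 1) l i j - ∑ k', (R.weight k' : ℂ) *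
          ((clip (m + 1) (overlap (R.vec k') l) : ℂ) * hiddenState (m + 1) l i j)))
      (uniformUnitVec (m + 1)) := fun k =>
    ((hcint _).const_mul _).add (hdiff _)
  rw [integral_finsetSum _ fun k _ => hterm k]
  -- Here `β` cancels between the clipped term and its normalisation.
  have hk : ∀ k, ∫ l, ((R.weight k : ℂ) *
        ((clip (m + 1) (overlap (R.vec k) l) : ℂ) * hiddenState (m + 1) l i j) +
        (R.weight k : ℂ) / (m + 1) * (hiddenState (m + 1) l i j - ∑ k', (R.weight k' : ℂ) *
          ((clip (m + 1) (overlap (R.vec k') l) : ℂ) * hiddenState (m + 1) l i j)))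
          ∂uniformUnitVec (m + 1) =
      R.weight k * ((((m : ℂ) + 1)⁻¹ ^ 2 + A / (m * (m + 1))) * δ) -
        A / m * (R.weight k * ketbra (R.vec k) i j) := by
    intro k
    rw [integral_add ((hcint _).const_mul _) (hdiff _), integral_const_mul,
      integral_const_mul, integral_sub hGint hsint, hc, hG, hs]
    field_simp
    ring
  simp_rw [hk]
  rw [Finset.sum_sub_distrib, ← Finset.sum_mul, ← Finset.mul_sum]
  have hM : M.elem a i j = ∑ k with R.label k = a, (R.weight k : ℂ) * ketbra (R.vec k) i j := by
    rw [R.elem_eq, Matrix.sum_apply]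
    rfl
  rw [← hM, R.trace_elem, hA]
  push_cast
  field_simp
  ring

theorem integral_barrettResponse_mul_hiddenState {m n : ℕ} (hm : m ≠ 0) (α : ℝ)
    (R : (n : ℕ) → (M : POVM (Fin (m + 1)) n) → RankOneRefinement M) (M : POVM (Fin (m + 1)) n)
    (a : Fin n) (i j : Fin (m + 1)) :
    ∫ l, (barrettResponse α R n M a l : ℂ) * hiddenState (m + 1) l i j ∂uniformUnitVec (m + 1) =
      (α / ((m + 1) * m) + (1 - α) / (m + 1) ^ 2) * (M.elem a).trace *
        (1 : Matrix (Fin (m + 1)) (Fin (m + 1)) ℂ) i j - α / ((m + 1) * m) * M.elem a i j := by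
  have := isProbabilityMeasure_uniformUnitVec (Nat.succ_pos m)
  have hm' : (m : ℂ) ≠ 0 := Nat.cast_ne_zero.2 hm
  have hm1 : (m : ℂ) + 1 ≠ 0 := Nat.cast_add_one_ne_zero m
  have hb : (barrettBound (m + 1) : ℂ) ≠ 0 :=
    Complex.ofReal_ne_zero.2 (barrettBound_pos (by omega)).ne'
  have hbound : ∀ l, |(R n M).response a l| ≤ 1 := fun l => by
    rw [abs_of_nonneg ((R n M).response_nonneg a l), ← (R n M).sum_response m.succ_ne_zero l]
    exact Finset.single_le_sum (fun b _ => (R n M).response_nonneg b l) (Finset.mem_univ a)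
  have hint := integrable_mul_hiddenState ((R n M).measurable_response a) hbound i j
  have hGint := integrable_hiddenState i j
  have hnoise : ((R n M).noise a : ℂ) = (M.elem a).trace / (m + 1) := by
    rw [(R n M).trace_elem, RankOneRefinement.noise, ← Finset.sum_div]
    push_cast
    rfl
  have hexp : ∀ l, (barrettResponse α R n M a l : ℂ) * hiddenState (m + 1) l i j =
      (α / barrettBound (m + 1) : ℂ) * ((R n M).response a l * hiddenState (m + 1) l i j) +
        ((1 - α / barrettBound (m + 1)) * ((M.elem a).trace / (m + 1)) : ℂ) *
          hiddenState (m + 1) l i j := by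
    intro l
    rw [barrettResponse, ← hnoise]
    push_cast
    ring
  simp_rw [hexp]
  rw [integral_add (hint.const_mul _) (hGint.const_mul _), integral_const_mul, integral_const_mul,
    integral_response_mul_hiddenState hm, integral_hiddenState hm]
  push_cast
  field_simp
  ring

/-! ### The assemblages of the Werner state -/

theorem swapMatrix_apply (d : ℕ) (i j k l : Fin d) : swapMatrix d (i, j) (k, l) =
    (1 : Matrix (Fin d) (Fin d) ℂ) i l * (1 : Matrix (Fin d) (Fin d) ℂ) j k := by
  simp [swapMatrix, Matrix.one_apply, Prod.ext_iff, and_comm, ← ite_and]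

theorem wernerState_apply (d : ℕ) (α : ℝ) (i j k l : Fin d) :
    wernerState d α (i, j) (k, l) =
      (α / (d * (d - 1)) + (1 - α) / d ^ 2 : ℂ) *
          ((1 : Matrix (Fin d) (Fin d) ℂ) i k * (1 : Matrix (Fin d) (Fin d) ℂ) j l) -
        α / (d * (d - 1)) *
          ((1 : Matrix (Fin d) (Fin d) ℂ) i l * (1 : Matrix (Fin d) (Fin d) ℂ) j k) := by
  have h1 : (1 : Matrix (Fin d × Fin d) (Fin d × Fin d) ℂ) (i, j) (k, l) =
      (1 : Matrix (Fin d) (Fin d) ℂ) i k * (1 : Matrix (Fin d) (Fin d) ℂ) j l := by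
    simp [Matrix.one_apply, Prod.ext_iff, and_comm, ← ite_and]
  simp only [wernerState, antisymProj, Matrix.add_apply, Matrix.smul_apply, Matrix.sub_apply, h1,
    swapMatrix_apply, smul_eq_mul]
  push_cast
  ring

theorem assemblageAtoB_wernerState (d : ℕ) (α : ℝ) {n : ℕ} (M : POVM (Fin d) n) (a : Fin n)
    (i j : Fin d) :
    assemblageAtoB (wernerState d α) n M a i j =
      (α / (d * (d - 1)) + (1 - α) / d ^ 2) * (M.elem a).trace *
        (1 : Matrix (Fin d) (Fin d) ℂ) i j - α / (d * (d - 1)) * M.elem a i j := by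
  simp only [assemblageAtoB, traceA, Matrix.of_apply, Matrix.mul_apply, Fintype.sum_prod_type,
    Matrix.kroneckerMap_apply, Matrix.trace, Matrix.diag]
  simp only [Matrix.one_apply (i := i), mul_ite, ite_mul, mul_one, mul_zero, zero_mul, Finset.sum_ite_eq,
    Finset.mem_univ, if_true]
  simp only [wernerState_apply]
  simp [Matrix.one_apply, mul_sub, ← Finset.sum_mul]
  split_ifs <;> ring

theorem assemblageBtoA_wernerState (d : ℕ) (α : ℝ) {n : ℕ} (M : POVM (Fin d) n) (a : Fin n)
    (i j : Fin d) :
    assemblageBtoA (wernerState d α) n M a i j =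
      (α / (d * (d - 1)) + (1 - α) / d ^ 2) * (M.elem a).trace *
        (1 : Matrix (Fin d) (Fin d) ℂ) i j - α / (d * (d - 1)) * M.elem a i j := by
  simp only [assemblageBtoA, traceB, Matrix.of_apply, Matrix.mul_apply, Fintype.sum_prod_type,
    Matrix.kroneckerMap_apply, Matrix.trace, Matrix.diag]
  simp only [Matrix.one_apply (i := i), mul_ite, ite_mul, one_mul, mul_zero, zero_mul, Finset.sum_ite_eq,
    Finset.mem_univ, if_true, Finset.sum_ite_irrel, Finset.sum_const_zero]
  simp only [wernerState_apply]
  simp [Matrix.one_apply, mul_sub, ← Finset.sum_mul]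
  split_ifs <;> ring

/-- Reduces joint statistics to the assemblage, so that an LHS model yields an LHV model. -/
theorem trace_kronecker_mul {ι κ : Type} [Fintype ι] [DecidableEq ι] [Fintype κ] [DecidableEq κ]
    (A : Matrix ι ι ℂ) (B : Matrix κ κ ℂ) (ρ : Matrix (ι × κ) (ι × κ) ℂ) :
    ((A ⊗ₖ B) * ρ).trace =
      (traceA ((A ⊗ₖ (1 : Matrix κ κ ℂ)) * ρ) * B).trace := by
  have h : A ⊗ₖ B = ((1 : Matrix ι ι ℂ) ⊗ₖ B) * (A ⊗ₖ (1 : Matrix κ κ ℂ)) := by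
    rw [← Matrix.mul_kronecker_mul, one_mul, mul_one]
  rw [h, Matrix.mul_assoc]
  set X := (A ⊗ₖ (1 : Matrix κ κ ℂ)) * ρ
  simp only [Matrix.trace, Matrix.diag, Matrix.mul_apply, traceA, Matrix.of_apply,
    Fintype.sum_prod_type, Matrix.kroneckerMap_apply, Matrix.one_apply, ite_mul, one_mul, zero_mul,
    Finset.sum_ite_irrel, Finset.sum_ite_eq, Finset.mem_univ, if_true, Finset.sum_const_zero]
  simp only [Finset.sum_mul]
  rw [Finset.sum_comm]
  refine Eq.trans (Finset.sum_congr rfl fun y _ => ?_) Finset.sum_comm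
  rw [Finset.sum_comm]
  exact Finset.sum_congr rfl fun y' _ => Finset.sum_congr rfl fun x _ => mul_comm _ _

theorem trace_kronecker_mul' {ι κ : Type} [Fintype ι] [DecidableEq ι] [Fintype κ] [DecidableEq κ]
    (A : Matrix ι ι ℂ) (B : Matrix κ κ ℂ) (ρ : Matrix (ι × κ) (ι × κ) ℂ) :
    ((A ⊗ₖ B) * ρ).trace =
      (traceB (((1 : Matrix ι ι ℂ) ⊗ₖ B) * ρ) * A).trace := by
  have h : A ⊗ₖ B = (A ⊗ₖ (1 : Matrix κ κ ℂ)) * ((1 : Matrix ι ι ℂ) ⊗ₖ B) := by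
    rw [← Matrix.mul_kronecker_mul, one_mul, mul_one]
  rw [h, Matrix.mul_assoc]
  set X := ((1 : Matrix ι ι ℂ) ⊗ₖ B) * ρ
  simp only [Matrix.trace, Matrix.diag, Matrix.mul_apply, traceB, Matrix.of_apply,
    Fintype.sum_prod_type, Matrix.kroneckerMap_apply, Matrix.one_apply, mul_ite, ite_mul, mul_one,
    mul_zero, zero_mul, Finset.sum_ite_eq, Finset.mem_univ, if_true]
  simp only [Finset.sum_mul]
  rw [Finset.sum_congr rfl fun x _ => Finset.sum_comm, Finset.sum_comm]
  exact Finset.sum_congr rfl fun y _ => Finset.sum_congr rfl fun y' _ =>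
    Finset.sum_congr rfl fun x _ => mul_comm _ _

/-! ### Entanglement through the swap witness -/

theorem antisymProj_posSemidef (d : ℕ) : (antisymProj d).PosSemidef := by
  rw [← antisymProj_mul_self]
  nth_rw 1 [← (antisymProj_isHermitian d).eq]
  exact Matrix.posSemidef_conjTranspose_mul_self _

theorem isState_wernerState {d : ℕ} (hd : 2 ≤ d) {α : ℝ} (h0 : 0 ≤ α) (h1 : α ≤ 1) :
    IsState (wernerState d α) := by
  have hd' : (2 : ℝ) ≤ d := by exact_mod_cast hd
  have hd1 : (0 : ℝ) < (d : ℝ) - 1 := by linarith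
  constructor
  · refine Matrix.PosSemidef.add ((antisymProj_posSemidef d).smul ?_)
      (Matrix.PosSemidef.one.smul ?_)
    · exact Complex.zero_le_real.2 (by positivity)
    · exact Complex.zero_le_real.2 (div_nonneg (by linarith) (by positivity))
  · have h2 : (d : ℂ) ≠ 0 := Nat.cast_ne_zero.2 (by omega)
    have h3 : (d : ℂ) - 1 ≠ 0 := by exact_mod_cast hd1.ne'
    simp only [Matrix.trace, Matrix.diag, Fintype.sum_prod_type, wernerState_apply]
    simp [Matrix.one_apply]
    field_simp
    ring

theorem trace_swapMatrix_mul_kronecker (d : ℕ) (σ τ : Matrix (Fin d) (Fin d) ℂ) :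
    (swapMatrix d * (σ ⊗ₖ τ)).trace = (σ * τ).trace := by
  simp only [Matrix.trace, Matrix.diag, Matrix.mul_apply, Fintype.sum_prod_type, swapMatrix_apply,
    Matrix.kroneckerMap_apply]
  simp [Matrix.one_apply]
  exact Finset.sum_comm

/-- Factor $\sigma=B^\ast B$ and use cyclicity: the trace is that of $B\tau B^\ast\ge0$. -/
theorem trace_mul_nonneg {d : ℕ} {σ τ : Matrix (Fin d) (Fin d) ℂ} (hσ : σ.PosSemidef)
    (hτ : τ.PosSemidef) : 0 ≤ (σ * τ).trace := by
  open scoped MatrixOrder Matrix.Norms.L2Operator in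
  obtain ⟨B, hB⟩ := CStarAlgebra.nonneg_iff_eq_star_mul_self.1 hσ.nonneg
  rw [hB, Matrix.star_eq_conjTranspose, Matrix.mul_assoc, Matrix.trace_mul_comm]
  exact (hτ.mul_mul_conjTranspose_same B).trace_nonneg

theorem IsSeparable.trace_swapMatrix_mul_nonneg {d : ℕ}
    {ρ : Matrix (Fin d × Fin d) (Fin d × Fin d) ℂ} (h : IsSeparable ρ) :
    0 ≤ (swapMatrix d * ρ).trace := by
  obtain ⟨k, p, σ, τ, hp, -, hσ, hτ, rfl⟩ := h
  rw [Finset.mul_sum, Matrix.trace_sum]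
  refine Finset.sum_nonneg fun i _ => ?_
  rw [Matrix.mul_smul, Matrix.trace_smul, trace_swapMatrix_mul_kronecker, smul_eq_mul]
  exact mul_nonneg (Complex.zero_le_real.2 (hp i))
    (trace_mul_nonneg (hσ i).posSemidef (hτ i).posSemidef)

theorem trace_swapMatrix_mul_wernerState {d : ℕ} (hd : 2 ≤ d) (α : ℝ) :
    (swapMatrix d * wernerState d α).trace = (((1 - α * (d + 1)) / d : ℝ) : ℂ) := by
  have hd' : (2 : ℝ) ≤ d := by exact_mod_cast hd
  have hd1 : (0 : ℝ) < (d : ℝ) - 1 := by linarith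
  have h2 : (d : ℂ) ≠ 0 := Nat.cast_ne_zero.2 (by omega)
  have h3 : (d : ℂ) - 1 ≠ 0 := by exact_mod_cast hd1.ne'
  simp only [Matrix.trace, Matrix.diag, Matrix.mul_apply, Fintype.sum_prod_type, swapMatrix_apply,
    wernerState_apply]
  simp [Matrix.one_apply]
  field_simp
  ring

/-- Guarantees that $\alpha\le1$, so that $\rho_W$ is positive. -/
theorem barrettBound_le_one {d : ℕ} (hd : 2 ≤ d) : barrettBound d ≤ 1 := by
  obtain ⟨m, rfl⟩ : ∃ m, d = m + 1 := ⟨d - 1, by omega⟩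
  rw [barrettBound_succ, ← div_eq_mul_inv, div_le_one (by positivity), pow_succ]
  have h1 : (m : ℝ) ^ m ≤ (m + 1) ^ m := by gcongr; linarith
  have h2 : (3 * m + 2) / (m + 2) ≤ (m + 1 : ℝ) := by
    rw [div_le_iff₀ (by positivity)]
    nlinarith [sq_nonneg (m : ℝ)]
  rw [mul_comm]
  exact mul_le_mul h1 h2 (by positivity) (by positivity)

theorem isEntangled_wernerState {d : ℕ} (hd : 2 ≤ d) {α : ℝ} (h0 : 1 / ((d : ℝ) + 1) < α)
    (h1 : α ≤ 1) : IsEntangled (wernerState d α) := by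
  have hpos : 0 < 1 / ((d : ℝ) + 1) := by positivity
  refine ⟨isState_wernerState hd (hpos.trans h0).le h1, fun hs => ?_⟩
  have h := hs.trace_swapMatrix_mul_nonneg
  rw [trace_swapMatrix_mul_wernerState hd, Complex.zero_le_real] at h
  have hd0 : (0 : ℝ) < d := by exact_mod_cast (by omega : 0 < d)
  rw [div_lt_iff₀ (by positivity)] at h0
  exact absurd h (not_le.2 (div_neg_of_neg_of_pos (by linarith) hd0))

/-! ### Existence of refinements, and the local models -/

/-- Every POVM has a rank-one fine-graining, obtained from the spectral decompositions of its
elements. -/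
theorem nonempty_rankOneRefinement {d n : ℕ} (M : POVM (Fin d) n) :
    Nonempty (RankOneRefinement M) := by
  let H := fun a => (M.posSemidef a).isHermitian
  let e := finProdFinEquiv (m := n) (n := d)
  -- One index per pair of an outcome and an eigenvector; zero eigenvalues are kept with weight 0.
  refine ⟨⟨n * d, fun k => (H (e.symm k).1).eigenvalues (e.symm k).2,
    fun k => (M.posSemidef _).eigenvalues_nonneg _,
    fun k => ⟨(H (e.symm k).1).eigenvectorBasis (e.symm k).2, by simp⟩,
    fun k => (e.symm k).1, fun a => ?_⟩⟩
  rw [Finset.sum_filter, ← e.sum_comp]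
  simp only [Equiv.symm_apply_apply, Fintype.sum_prod_type]
  rw [Finset.sum_eq_single a (by intro b _ hb; simp [hb]) (by simp)]
  simp only [if_true]
  conv_lhs => rw [(H a).spectral_theorem]
  ext i j
  rw [Unitary.conjStarAlgAut_apply, Matrix.sum_apply, Matrix.mul_apply]
  refine Finset.sum_congr rfl fun k _ => ?_
  rw [Matrix.mul_diagonal]
  simp [ketbra, Matrix.star_apply, Matrix.IsHermitian.eigenvectorUnitary_apply]
  ring

theorem isLHSModel_barrettResponse {d : ℕ} (hd : 2 ≤ d) {α : ℝ} (hα₀ : 0 ≤ α)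
    (hα : α ≤ barrettBound d) (R : (n : ℕ) → (M : POVM (Fin d) n) → RankOneRefinement M)
    {S : (n : ℕ) → POVM (Fin d) n → Fin n → Matrix (Fin d) (Fin d) ℂ}
    (hS : ∀ n M a i j, S n M a i j =
      (α / (d * (d - 1)) + (1 - α) / d ^ 2) * (M.elem a).trace *
        (1 : Matrix (Fin d) (Fin d) ℂ) i j - α / (d * (d - 1)) * M.elem a i j) :
    IsLHSModel S (uniformUnitVec d) (hiddenState d) (barrettResponse α R) where
  isProbabilityMeasure := isProbabilityMeasure_uniformUnitVec (by omega)
  measurable_state i j := (continuous_hiddenState_apply d i j).measurable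
  isState := isState_hiddenState hd
  isResponse := isResponse_barrettResponse hd hα₀ hα R
  reproduces n M a i j := by
    obtain ⟨m, rfl⟩ : ∃ m, d = m + 1 := ⟨d - 1, by omega⟩
    rw [hS, integral_barrettResponse_mul_hiddenState (by omega)]
    push_cast
    rw [add_sub_cancel_right]

/-- If the hidden states answer with the quantum response, a local hidden state model reproduces
the traces of the assemblage against all effects. -/
theorem IsLHSModel.trace_mul {d : ℕ}
    {S : (n : ℕ) → POVM (Fin d) n → Fin n → Matrix (Fin d) (Fin d) ℂ}
    {p : (n : ℕ) → POVM (Fin d) n → Fin n → UnitVec d → ℝ}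
    (h : IsLHSModel S (uniformUnitVec d) (hiddenState d) p)
    (R : (n : ℕ) → (M : POVM (Fin d) n) → RankOneRefinement M)
    {m n : ℕ} (M : POVM (Fin d) m) (N : POVM (Fin d) n) (a : Fin m) (b : Fin n) :
    (S m M a * N.elem b).trace =
      ((∫ l, p m M a l * barrettQuantumResponse R n N b l ∂uniformUnitVec d : ℝ) : ℂ) := by
  have hint := integrable_mul_hiddenState (h.isResponse.measurable m M a)
    (h.isResponse.abs_le_one m M a)
  rw [← integral_complex_ofReal]
  have hexp : ∀ l, ((p m M a l * barrettQuantumResponse R n N b l : ℝ) : ℂ) =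
      ∑ i, ∑ j, (p m M a l * hiddenState d l i j) * N.elem b j i := by
    intro l
    rw [Complex.ofReal_mul, barrettQuantumResponse, RankOneRefinement.quantumResponse_eq_trace]
    simp only [Matrix.trace, Matrix.diag, Matrix.mul_apply, Finset.mul_sum, mul_assoc]
  simp_rw [hexp]
  rw [integral_finsetSum _ fun i _ => integrable_finsetSum _ fun j _ => (hint i j).mul_const _]
  simp only [Matrix.trace, Matrix.diag, Matrix.mul_apply]
  refine Finset.sum_congr rfl fun i _ => ?_
  rw [integral_finsetSum _ fun j _ => (hint i j).mul_const _]
  refine Finset.sum_congr rfl fun j _ => ?_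
  rw [integral_mul_const, h.reproduces]

end Steering

end

theorem mainTheorem4 (d : ℕ) (hd : 2 ≤ d) (α : ℝ)
    (hα₁ : 1 / ((d : ℝ) + 1) < α)
    (hα₂ : α ≤ (3 * (d : ℝ) - 1) / ((d : ℝ) + 1) * ((d : ℝ) - 1) ^ (d - 1) * ((d : ℝ) ^ d)⁻¹) :
    Steering.IsEntangled (Steering.wernerState d α) ∧
    Nonempty ((n : ℕ) → (M : Steering.POVM (Fin d) n) → Steering.RankOneRefinement M) ∧
    (∀ R : (n : ℕ) → (M : Steering.POVM (Fin d) n) → Steering.RankOneRefinement M,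
      Steering.IsLHVModel (Steering.wernerState d α) (Steering.uniformUnitVec d)
        (Steering.barrettResponse α R) (Steering.barrettQuantumResponse R) ∧
      Steering.IsLHVModel (Steering.wernerState d α) (Steering.uniformUnitVec d)
        (Steering.barrettQuantumResponse R) (Steering.barrettResponse α R) ∧
      (∀ (n : ℕ) (M : Steering.POVM (Fin d) n) (a : Fin n) (l : Steering.UnitVec d),
        (Steering.barrettQuantumResponse R n M a l : ℂ) =
          (Steering.hiddenState d l * M.elem a).trace) ∧
      Steering.IsLHSModel (Steering.assemblageAtoB (Steering.wernerState d α))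
        (Steering.uniformUnitVec d) (Steering.hiddenState d) (Steering.barrettResponse α R) ∧
      Steering.IsLHSModel (Steering.assemblageBtoA (Steering.wernerState d α))
        (Steering.uniformUnitVec d) (Steering.hiddenState d) (Steering.barrettResponse α R)) ∧
    Steering.UnsteerableAtoB (Steering.wernerState d α) ∧
    Steering.UnsteerableBtoA (Steering.wernerState d α) := by
  have hpos : 0 < 1 / ((d : ℝ) + 1) := by positivity
  have hα₀ : 0 ≤ α := (hpos.trans hα₁).le
  have hα : α ≤ Steering.barrettBound d := hα₂
  have hA := fun R => Steering.isLHSModel_barrettResponse hd hα₀ hα R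
    fun n M a i j => Steering.assemblageAtoB_wernerState d α M a i j
  have hB := fun R => Steering.isLHSModel_barrettResponse hd hα₀ hα R
    fun n M a i j => Steering.assemblageBtoA_wernerState d α M a i j
  have hR : Nonempty ((n : ℕ) → (M : Steering.POVM (Fin d) n) → Steering.RankOneRefinement M) :=
    ⟨fun _ M => (Steering.nonempty_rankOneRefinement M).some⟩
  refine ⟨Steering.isEntangled_wernerState hd hα₁ (hα.trans (Steering.barrettBound_le_one hd)), hR,
    fun R => ⟨?_, ?_, fun n M a l => (R n M).quantumResponse_eq_trace a l, hA R, hB R⟩,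
    ⟨_, _, _, _, _, hA hR.some⟩, ⟨_, _, _, _, _, hB hR.some⟩⟩
  · refine ⟨(hA R).isProbabilityMeasure, (hA R).isResponse,
      Steering.isResponse_barrettQuantumResponse hd R, fun m n M N a b => ?_⟩
    rw [Steering.trace_kronecker_mul]
    exact (hA R).trace_mul R M N a b
  · refine ⟨(hA R).isProbabilityMeasure, Steering.isResponse_barrettQuantumResponse hd R,
      (hA R).isResponse, fun m n M N a b => ?_⟩
    rw [Steering.trace_kronecker_mul']
    -- With the roles exchanged, the hidden states are Alice's, so the Bob-to-Alice model is paired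
    -- with her effect.
    simp_rw [mul_comm (Steering.barrettQuantumResponse R m M a _)]
    exact (hB R).trace_mul R N M b a
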